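/- **Setting.** Let $\mathcal X\subset\mathbb R^{d_0}$ and let $\mathcal V$ be a class of functions $\mathcal X\to\mathbb R$. In round $t=1,2,\dots$ a context $\bm x_t\in\mathcal X$ is observed, a price $p_t$ is posted, and $y_t=\mathbb 1\{p_t\le v^*(\bm x_t)+\epsilon_t\}$ is observed. The contexts are i.i.d., the noise terms $\epsilon_t$ are i.i.d. with mean zero and distribution function $F$, and contexts, noise and the uniform draws used by the seller are independent. Put $\mathsf{Rev}_t(p)=p\,(1-F(p-v^*(\bm x_t)))$, let $p_t^*\in\arg\max_{p\ge0}\mathsf{Rev}_t(p)$, and let $\mathrm{Reg}(T)=\sum_{t=1}^T(\mathsf{Rev}_t(p_t^*)-\mathsf{Rev}_t(p_t))$. Assume: $v^*\in\mathcal V$; there are constants $B,B_\epsilon>0$ with $|\epsilon_t|\le B_\epsilon$ almost surely and $v^*(\bm x)\in[B_\epsilon,B-B_\epsilon]$ for all $\bm x\in\mathcal X$; $|F(a)-F(b)|\le L|a-b|$ for all $a,b$, where $L>0$. **Oracle.** Let $\alpha>0$, $\delta>0$ and $\rho=\rho_{\mathcal V}(\delta)>1$. The regression oracle maps $n\ge1$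 i.i.d. samples $(\bm x_i,y_i)$ whose law satisfies $\mathbb E[By_i\mid\bm x_i]=v^*(\bm x_i)$ to a predictor $\hat v\in\mathcal V$ with $\|\hat v-v^*\|_\infty\le\sqrt{\rho/n^{\alpha}}$ with probability at least $1-\delta$; this guarantee is used for the law of $(\bm x,\mathbb 1\{p\le v^*(\bm x)+\epsilon\})$ with $p\sim\mathrm{Unif}(0,B)$ independent of $(\bm x,\epsilon)$. The oracle is deterministic and measurable. **Algorithm 1.** Let $k^*=\lceil\log_2\rho\rceil$. In rounds $1,\dots,2^{k^*-1}$ post $p_t\sim\mathrm{Unif}(0,B)$. For $k=k^*,k^*+1,\dots$, episode $k$ consists of the rounds $2^{k-1}+1,\dots,2^k$; put $\ell_k=2^{k-1}$ and $$T_k^e=\min\bigl\{\lceil\rho^{\frac1{2+\alpha}}\ell_k^{\frac2{2+\alpha}}\rceil,\ \ell_k\bigr\},\qquad T_k=\ell_k-T_k^e .$$ In the first $T_k^e$ rounds of the episode post $p_t\sim\mathrm{Unif}(0,B)$ and feed the pairs $(\bm x_t,y_t)$ of these rounds to the oracle to obtain $\hat v_k$. In the remaining $T_k$ rounds run the following procedure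 with $N=N_k=\lceil T_k^{1/3}/\ln^{1/3}(T_k/\delta)\rceil$ and $S=\lceil\frac12\log_2T_k\rceil$ (replaced by $1$ if $T_k=1$). Let $m_1,\dots,m_N$ be the midpoints of the $N$ equal parts of $[-\|\hat v_k\|_\infty,B+\|\hat v_k\|_\infty]$. For a layer $s$ and arm $j$, let $\Psi_t^s(j)$ be the set of earlier rounds of this phase that stopped at layer $s$ and used arm $j$. Let $w^j_{t,s}$ be the mean of $y_\tau$ over $\tau\in\Psi_t^s(j)$ and let $r^j_{t,s}=\min\{\sqrt{2\ln(2SNT_k/\delta)/|\Psi_t^s(j)|},1\}$; if $\Psi^s_t(j)=\emptyset$, then $w^j_{t,s}=0$ and $r^j_{t,s}=1$. Let $\mathrm{UCB}^j_{t,s}=(m_j+\hat v_k(\bm x_t))(w^j_{t,s}+r^j_{t,s})$. Start with $s=1$ and $\mathcal A_{t,1}=\{j: m_j+\hat v_k(\bm x_t)\in(0,B)\}$ and repeat: * if $s=S$, choose $j_t\in\arg\max_{j\in\mathcal A_{t,s}}\mathrm{UCB}^j_{t,s}$ and stop; * if $s<S$ and some $j\in\mathcal A_{t,s}$ has $(m_j+\hat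 v_k(\bm x_t))r^j_{t,s}>B2^{-s}$, choose any such $j$ as $j_t$ and stop; * otherwise put $\mathcal A_{t,s+1}=\{j\in\mathcal A_{t,s}:\mathrm{UCB}^j_{t,s}\ge\max_{i\in\mathcal A_{t,s}}\mathrm{UCB}^i_{t,s}-B2^{1-s}\}$ and increase $s$ by $1$. Post $p_t=m_{j_t}+\hat v_k(\bm x_t)$. If $\mathcal A_{t,1}=\emptyset$, post $p_t\sim\mathrm{Unif}(0,B)$ and do not record the round in any $\Psi^s(j)$. Arbitrary choices and ties are resolved by any measurable rule that depends on the past and on $\bm x_t$. **Corollary.** There is an absolute constant $\kappa\in\mathbb N$ and, for all $B,L>0$, a constant $C=C(B,L)>0$ such that in every instance as above, for every integer $T\ge2$ and every $0<\delta<\frac1{2\lceil\log_2T\rceil}$, with probability at least $1-2\lceil\log_2T\rceil\,\delta$, $$\mathrm{Reg}(T)\le C\,\Bigl(\ln\frac T\delta\Bigr)^{\kappa}\,\max\Bigl\{\rho^{\frac13}T^{\frac23},\ \rho^{\frac1{2+\alpha}}T^{\frac2{2+\alpha}}\Bigr\}.$$ -/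

import Mathlib

open MeasureTheory ProbabilityTheory
open scoped ENNReal

namespace DynamicPricing

/-! Rounds are indexed from `0`: index `t` is round `t + 1` of the usual description. Hence the rounds
`2 ^ (k - 1) + 1, …, 2 ^ k` of episode `k` are the indices `t` with `2 ^ (k - 1) ≤ t < 2 ^ k`, and
the history available before index `t` is a function on `Fin t`. -/

/-- Everything the seller remembers about one round: the context, the posted price, the sale
indicator, and (for rounds of a UCB phase) the stopping layer and the index of the chosen arm.
Uniformly priced rounds carry layer `0` and arm `0`; genuine layers and arms are numbered from `1`. -/
abbrev Rec (X : Type*) := X × ℝ × Bool × ℕ × ℕ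

namespace Rec
variable {X : Type*}
def ctx (z : Rec X) : X := z.1
def price (z : Rec X) : ℝ := z.2.1
def sale (z : Rec X) : Bool := z.2.2.1
def layer (z : Rec X) : ℕ := z.2.2.2.1
def arm (z : Rec X) : ℕ := z.2.2.2.2
end Rec

/-- An offline regression oracle: it maps a data set of `n` pairs (context, sale indicator) to a
predictor. -/
abbrev Oracle (X : Type*) := (n : ℕ) → (Fin n → X × Bool) → X → ℝ

/-- A rule that resolves the arbitrary choices of an index from a finite set (ties in an argmax,
"choose an arbitrary index"). It may depend on the whole past and on the current context. -/
abbrev Selector (X : Type*) := (t : ℕ) → (Fin t → Rec X) → X → Finset ℕ → ℕ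

/-- A pricing policy: from the past, the current context and the current draw from `Unif(0, B)`
it computes (price, stopping layer, arm). -/
abbrev Policy (X : Type*) := (t : ℕ) → (Fin t → Rec X) → X → ℝ → ℝ × ℕ × ℕ

noncomputable section

/-! ### The UCB algorithm with layered data partitioning -/

/-- The sup norm of a (bounded) function. -/
def supNorm {X : Type*} (v : X → ℝ) : ℝ := ⨆ x, |v x|

/-- The midpoint of the `j`-th (`1 ≤ j ≤ N`) of the `N` intervals of equal length into which
`[-‖v‖_∞, B + ‖v‖_∞]` is divided; here `M = ‖v‖_∞`. -/
def midpoint (B M : ℝ) (N j : ℕ) : ℝ := -M + ((j : ℝ) - 1 / 2) * ((B + 2 * M) / N)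

/-- The number of layers for a phase of length `n`. -/
def numLayers (n : ℕ) : ℕ := ⌈(1 / 2 : ℝ) * Real.logb 2 n⌉₊

section UCB

variable {X : Type*} {t : ℕ}

/-- The past rounds of the current phase (the phase starts at index `start`) that stopped at layer
`s` and used arm `j`. -/
def armRounds (start : ℕ) (h : Fin t → Rec X) (s j : ℕ) : Finset (Fin t) :=
  Finset.univ.filter fun τ => start ≤ (τ : ℕ) ∧ (h τ).layer = s ∧ (h τ).arm = j

/-- The empirical sale frequency of arm `j` at layer `s` (zero if there are no data). -/
def sampleMean (start : ℕ) (h : Fin t → Rec X) (s j : ℕ) : ℝ :=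
  (∑ τ ∈ armRounds start h s j, if (h τ).sale then (1 : ℝ) else 0) / (armRounds start h s j).card

/-- The confidence radius `min {√(2 ln(2 S N n / δ) / #rounds), 1}`, equal to `1` if there are no
data; `n` is the length of the phase, `S` the number of layers, `N` the number of arms. -/
def radius (start N n : ℕ) (δ : ℝ) (h : Fin t → Rec X) (s j : ℕ) : ℝ :=
  if (armRounds start h s j).card = 0 then 1
  else min (Real.sqrt (2 * Real.log (2 * numLayers n * N * n / δ) / (armRounds start h s j).card)) 1

/-- The price attached to arm `j` at context `x` by the estimator `v`. -/
def armPrice (B : ℝ) (v : X → ℝ) (N : ℕ) (x : X) (j : ℕ) : ℝ :=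
  midpoint B (supNorm v) N j + v x

/-- The upper confidence bound for the revenue of arm `j` at layer `s`. Without data it is the trivial
bound `armPrice * (0 + 1)`. -/
def ucb (start N n : ℕ) (B δ : ℝ) (v : X → ℝ) (h : Fin t → Rec X) (x : X) (s j : ℕ) : ℝ :=
  armPrice B v N x j * (sampleMean start h s j + radius start N n δ h s j)

open Classical in
/-- The arms whose price lies in `(0, B)`. -/
def initialArms (B : ℝ) (v : X → ℝ) (N : ℕ) (x : X) : Finset ℕ :=
  (Finset.Icc 1 N).filter fun j => 0 < armPrice B v N x j ∧ armPrice B v N x j < B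

open Classical in
/-- The arms of `A` that fail the precision check at layer `s`. -/
def failingArms (start N n : ℕ) (B δ : ℝ) (v : X → ℝ) (h : Fin t → Rec X) (x : X) (s : ℕ)
    (A : Finset ℕ) : Finset ℕ :=
  A.filter fun j =>
    B * (2 : ℝ) ^ (-(s : ℤ)) < armPrice B v N x j * radius start N n δ h s j

open Classical in
/-- The arms of `A` whose upper confidence bound is within `B * 2 ^ (1 - s)` of the maximum. -/
def survivingArms (start N n : ℕ) (B δ : ℝ) (v : X → ℝ) (h : Fin t → Rec X) (x : X) (s : ℕ)
    (A : Finset ℕ) : Finset ℕ :=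
  A.filter fun j => ∀ i ∈ A,
    ucb start N n B δ v h x s i - B * (2 : ℝ) ^ (1 - (s : ℤ)) ≤ ucb start N n B δ v h x s j

open Classical in
/-- The arms of `A` with the highest upper confidence bound at layer `s`. -/
def bestArms (start N n : ℕ) (B δ : ℝ) (v : X → ℝ) (h : Fin t → Rec X) (x : X) (s : ℕ)
    (A : Finset ℕ) : Finset ℕ :=
  A.filter fun j => ∀ i ∈ A, ucb start N n B δ v h x s i ≤ ucb start N n B δ v h x s j

open Classical in
/-- The layer traversal, started at layer `s` with action set `A` and `fuel` layers above `s`.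
It returns the stopping layer and the chosen arm. With `S = numLayers n ≥ 1` it is run from layer `1`
with `S - 1` layers above, so that the last layer is `S`. -/
def traverse (start N n : ℕ) (B δ : ℝ) (v : X → ℝ) (h : Fin t → Rec X) (x : X)
    (pick : Finset ℕ → ℕ) : (fuel s : ℕ) → Finset ℕ → ℕ × ℕ
  | 0, s, A => (s, pick (bestArms start N n B δ v h x s A))
  | fuel + 1, s, A =>
    if (failingArms start N n B δ v h x s A).Nonempty then
      (s, pick (failingArms start N n B δ v h x s A))
    else
      traverse start N n B δ v h x pick fuel (s + 1) (survivingArms start N n B δ v h x s A)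

open Classical in
/-- One round of the UCB phase. If no arm has its price in `(0, B)`, the price `u` is posted
and the round is not assigned to any arm. -/
def ucbRound (start N n : ℕ) (B δ : ℝ) (v : X → ℝ) (h : Fin t → Rec X) (x : X)
    (pick : Finset ℕ → ℕ) (u : ℝ) : ℝ × ℕ × ℕ :=
  if (initialArms B v N x).Nonempty then
    let a := traverse start N n B δ v h x pick (numLayers n - 1) 1 (initialArms B v N x)
    (armPrice B v N x a.2, a.1, a.2)
  else (u, 0, 0)

end UCB

/-! ### The episodic pricing algorithm -/

/-- The length `ℓ_k = 2 ^ (k - 1)` of episode `k ≥ 1`; it is also the first index of episode `k`. -/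
def episodeLength (k : ℕ) : ℕ := 2 ^ (k - 1)

/-- The episode of index `t ≥ 1`: the `k` with `2 ^ (k - 1) ≤ t < 2 ^ k`. -/
def episodeOf (t : ℕ) : ℕ := Nat.log 2 t + 1

/-- The first episode after the warm-up, `k⋆ = ⌈log₂ ρ⌉`. -/
def firstEpisode (ρ : ℝ) : ℕ := ⌈Real.logb 2 ρ⌉₊

/-- The number of discretization points for a UCB phase of length `n`. -/
def numArms (n : ℕ) (δ : ℝ) : ℕ :=
  ⌈(n : ℝ) ^ (1 / 3 : ℝ) / Real.log (n / δ) ^ (1 / 3 : ℝ)⌉₊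

/-- The exploration length `ρ ^ (1 / (2 + α)) ℓ_k ^ (2 / (2 + α))`, rounded up to an integer and
capped by the length of the episode. -/
def explorationLength (ρ α : ℝ) (k : ℕ) : ℕ :=
  min ⌈ρ ^ (1 / (2 + α)) * (episodeLength k : ℝ) ^ (2 / (2 + α))⌉₊ (episodeLength k)

/-- The samples (context, sale indicator) collected at the indices `a, …, a + n - 1`. -/
def samples {X : Type*} {t : ℕ} (h : Fin t → Rec X) (a n : ℕ) (han : a + n ≤ t) :
    Fin n → X × Bool :=
  fun i => ((h ⟨a + i, by omega⟩).ctx, (h ⟨a + i, by omega⟩).sale)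

open Classical in
/-- The episodic algorithm with exploration lengths `Te`: uniform prices during the warm-up and
during the exploration phase of each episode, then a regression on the exploration data of the
episode, then the UCB phase. -/
def pricingAlgorithm {X : Type*} (B ρ δ : ℝ) (Te : ℕ → ℕ) (orc : Oracle X) (sel : Selector X) :
    Policy X := fun t h x u =>
  let k := episodeOf t
  if t < episodeLength (firstEpisode ρ) then (u, 0, 0)
  else if hk : episodeLength k + Te k ≤ t then
    let vhat := orc (Te k) (samples h (episodeLength k) (Te k) hk)
    let n := episodeLength k - Te k
    ucbRound (episodeLength k + Te k) (numArms n δ) n B δ vhat h x (sel t h x) u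
  else (u, 0, 0)

/-! ### The market -/

/-- The history generated by a policy when `x`, `e`, `u` are the contexts, the noise terms and the
uniform draws: a sale occurs at index `t` if and only if the price is at most `vstar (x t) + e t`. -/
def history {X : Type*} (pol : Policy X) (vstar : X → ℝ) (x : ℕ → X) (e u : ℕ → ℝ) :
    (t : ℕ) → Fin t → Rec X
  | 0 => Fin.elim0
  | t + 1 =>
    let past := history pol vstar x e u t
    let a := pol t past (x t) (u t)
    Fin.snoc (α := fun _ => Rec X) past (x t, a.1, decide (a.1 ≤ vstar (x t) + e t), a.2.1, a.2.2)

/-- The price posted at index `t`. -/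
def postedPrice {X : Type*} (pol : Policy X) (vstar : X → ℝ) (x : ℕ → X) (e u : ℕ → ℝ) (t : ℕ) :
    ℝ :=
  (pol t (history pol vstar x e u t) (x t) (u t)).1

/-- The expected revenue of price `p` when the valuation function takes the value `v` and the noise
has distribution function `F`. -/
def revenue (F : ℝ → ℝ) (v p : ℝ) : ℝ := p * (1 - F (p - v))

/-- `pstar` is an optimal pricing function: at each context it maximizes the expected revenue over
all nonnegative prices. -/
def IsOptimalPricing {X : Type*} (F : ℝ → ℝ) (vstar pstar : X → ℝ) : Prop :=
  ∀ x, 0 ≤ pstar x ∧ ∀ p, 0 ≤ p → revenue F (vstar x) p ≤ revenue F (vstar x) (pstar x)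

/-- The cumulative regret over `T` rounds. -/
def regret {X : Type*} (F : ℝ → ℝ) (pol : Policy X) (vstar pstar : X → ℝ) (x : ℕ → X)
    (e u : ℕ → ℝ) (T : ℕ) : ℝ :=
  ∑ t ∈ Finset.range T, (revenue F (vstar (x t)) (pstar (x t)) -
    revenue F (vstar (x t)) (postedPrice pol vstar x e u t))

/-- The uniform distribution on `(0, B)`. -/
def uniformPrice (B : ℝ) : Measure ℝ := ProbabilityTheory.cond volume (Set.Ioo 0 B)

/-- The triples (context, noise, uniform draw) are i.i.d. over the rounds; within a round the
context has law `PX`, the noise has law `ν`, the draw is uniform on `(0, B)`, and the three are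
independent. -/
structure IsMarket {Ω X : Type*} [MeasurableSpace Ω] [MeasurableSpace X] (μ : Measure Ω)
    (PX : Measure X) (ν : Measure ℝ) (B : ℝ) (x : ℕ → Ω → X) (e u : ℕ → Ω → ℝ) : Prop where
  measurable_x : ∀ t, Measurable (x t)
  measurable_e : ∀ t, Measurable (e t)
  measurable_u : ∀ t, Measurable (u t)
  law : ∀ t, μ.map (fun ω => (x t ω, e t ω, u t ω)) = PX.prod (ν.prod (uniformPrice B))
  indep : iIndepFun (fun t ω => (x t ω, e t ω, u t ω)) μ

/-! ### The regression oracle -/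

/-- The joint law of the context and the sale indicator when the price is uniform on `(0, B)`. -/
def explorationLaw {X : Type*} [MeasurableSpace X] (PX : Measure X) (ν : Measure ℝ) (B : ℝ)
    (vstar : X → ℝ) : Measure (X × Bool) :=
  (PX.prod (ν.prod (uniformPrice B))).map
    (fun z => (z.1, decide (z.2.2 ≤ vstar z.1 + z.2.1)))

/-- `E[B y | x] = vstar x` under the law `D` of `(x, y)`. -/
def MomentCondition {X : Type*} [MeasurableSpace X] (B : ℝ) (vstar : X → ℝ)
    (D : Measure (X × Bool)) : Prop :=
  (D[(fun z : X × Bool => B * (if z.2 then (1 : ℝ) else 0)) |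
    MeasurableSpace.comap (Prod.fst : X × Bool → X) inferInstance])
    =ᵐ[D] fun z => vstar z.1

/-- The general offline regression oracle at confidence level `δ`, for i.i.d. data with law `D`: the
predictor lies in `V`, and if `E[B y | x] = vstar x`, then with probability at least `1 - δ` its
sup-norm error on `n` samples is at most `√(ρ / n ^ α)`. -/
def IsGeneralOfflineOracle {X : Type*} [MeasurableSpace X] (V : Set (X → ℝ)) (B : ℝ)
    (vstar : X → ℝ) (ρ α δ : ℝ) (D : Measure (X × Bool)) (orc : Oracle X) : Prop :=
  (∀ n S, orc n S ∈ V) ∧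
  (MomentCondition B vstar D → ∀ n : ℕ, 0 < n →
    Measure.pi (fun _ : Fin n => D)
      {S | ¬ ∀ x, |orc n S x - vstar x| ≤ Real.sqrt (ρ / (n : ℝ) ^ α)} ≤ ENNReal.ofReal δ)

/-- Measurability of the predictor, jointly in data and context, and of its sup norm. -/
def MeasurableOracle {X : Type*} [MeasurableSpace X] (orc : Oracle X) : Prop :=
  ∀ n, Measurable (fun z : (Fin n → X × Bool) × X => orc n z.1 z.2) ∧
    Measurable (fun S : Fin n → X × Bool => supNorm (orc n S))

/-- An admissible selector picks an element of every nonempty set, measurably in the past and the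
current context. -/
def AdmissibleSelector {X : Type*} [MeasurableSpace X] (sel : Selector X) : Prop :=
  (∀ t h x A, A.Nonempty → sel t h x A ∈ A) ∧
  ∀ t A, Measurable (fun z : (Fin t → Rec X) × X => sel t z.1 z.2 A)

end

end DynamicPricing

namespace DynamicPricing

/-! Why the bound holds. Arm `j` posts `m_j + v̂(x)`, which sells with probability `1 - F(m_j +
v̂(x) - v*(x))`. As `F` is `L`-Lipschitz, this is within `L‖v̂ - v*‖` of `1 - F(m_j)`, whatever the
context. All rounds that used one arm therefore estimate a single number, up to a bias controlled by
the regression error (`abs_sampleMean_sub_le`, `ucb_bounds`). Pricing becomes a bandit problem with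
`N` arms and a small misspecification.

Layers turn precision into regret. On the event that all confidence radii are valid, an arm that
reaches layer `s` is suboptimal by at most `8 B 2^(-s)` plus a bias linear in `s` (`traverse_spec`).
A round that stops below the last layer does so because its radius exceeds `2^(-s)`, which bounds
the number of such rounds (`weight_mul_card_le`). With a threshold `θ`, the weights `2^(-s)` of a
phase of length `n` sum to at most `(2^(-S) + θ) n + S N (1 + 2Λ)/θ` (`sum_layer_weights_le`). The
choice `θ = n^(-1/3)`, with `N` of order at most `n^(1/3)`, makes this and the discretization loss
`n/N` of order `n^(2/3)` up to logarithms. The exploration length is the value at which the cost of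
exploring equals the cost `ℓ · err` of the regression error (`oracle_error_le`), and this gives the
second term of the maximum. The warm-up lasts at most `ρ` rounds and costs at most `B min(T, ρ)`.

Two events per episode can fail, each with probability at most `δ`. First, exploration prices are
raw uniform draws, so the oracle sees i.i.d. data, and bounded noise gives the moment condition
(`momentCondition_explorationLaw`, `measure_oracle_error_le`). Second, the confidence radii hold by
an exponential supermartingale (`lintegral_exp_armExponent_le`) and a union bound over rounds,
layers, arms and sample sizes (`measure_phase_deviation_le`). At most `⌈log₂ T⌉` episodes meet the
horizon. Each contributes two logarithmic factors and their number contributes a third. -/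

/-- The record of round `t` in the history generated by a policy. -/
noncomputable def roundRec {X : Type*} (pol : Policy X) (vstar : X → ℝ) (x : ℕ → X) (e u : ℕ → ℝ)
    (t : ℕ) : Rec X :=
  let a := pol t (history pol vstar x e u t) (x t) (u t)
  (x t, a.1, decide (a.1 ≤ vstar (x t) + e t), a.2.1, a.2.2)

lemma history_succ {X : Type*} (pol : Policy X) (vstar : X → ℝ) (x : ℕ → X) (e u : ℕ → ℝ)
    (t : ℕ) : history pol vstar x e u (t + 1) =
      Fin.snoc (α := fun _ => Rec X) (history pol vstar x e u t) (roundRec pol vstar x e u t) := rfl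

lemma history_apply {X : Type*} (pol : Policy X) (vstar : X → ℝ) (x : ℕ → X) (e u : ℕ → ℝ)
    (t : ℕ) (i : Fin t) : history pol vstar x e u t i = roundRec pol vstar x e u i := by
  induction t with
  | zero => exact i.elim0
  | succ t ih =>
    rw [history_succ]
    refine Fin.lastCases ?_ (fun i => ?_) i
    · simp
    · simp [ih]

/-- A policy is measurable if each of its decision rules is. -/
def MeasurablePolicy {X : Type*} [MeasurableSpace X] (pol : Policy X) : Prop :=
  ∀ t, Measurable fun z : (Fin t → Rec X) × X × ℝ => pol t z.1 z.2.1 z.2.2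

/-- The record of a round as a function of the past and of (context, noise, uniform draw). -/
noncomputable def outcome {X : Type*} (pol : Policy X) (vstar : X → ℝ) (t : ℕ)
    (z : (Fin t → Rec X) × X × ℝ × ℝ) : Rec X :=
  let a := pol t z.1 z.2.1 z.2.2.2
  (z.2.1, a.1, decide (a.1 ≤ vstar z.2.1 + z.2.2.1), a.2.1, a.2.2)

/-! ### Measurability of histories and independence of the past from the current round. -/

section Measurability

variable {X Ω : Type*} [MeasurableSpace X]

lemma measurable_decide_le {Z : Type*} [MeasurableSpace Z] {f g : Z → ℝ} (hf : Measurable f)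
    (hg : Measurable g) : Measurable fun z => decide (f z ≤ g z) := by
  refine measurable_to_bool ?_
  have : (fun z => decide (f z ≤ g z)) ⁻¹' {true} = {z | f z ≤ g z} := by ext; simp
  rw [this]
  exact measurableSet_le hf hg

lemma measurable_outcome {pol : Policy X} (hpol : MeasurablePolicy pol) {vstar : X → ℝ}
    (hv : Measurable vstar) (t : ℕ) : Measurable (outcome pol vstar t) := by
  have ha : Measurable fun z : (Fin t → Rec X) × X × ℝ × ℝ => pol t z.1 z.2.1 z.2.2.2 :=
    (hpol t).comp (f := fun z : (Fin t → Rec X) × X × ℝ × ℝ => (z.1, z.2.1, z.2.2.2))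
      (by fun_prop)
  exact Measurable.prodMk (by fun_prop) (ha.fst.prodMk
    ((measurable_decide_le ha.fst (by fun_prop)).prodMk ha.snd))

lemma measurable_history {pol : Policy X} (hpol : MeasurablePolicy pol) {vstar : X → ℝ}
    (hv : Measurable vstar) {m : MeasurableSpace Ω} {x : ℕ → Ω → X} {e u : ℕ → Ω → ℝ} (t : ℕ)
    (h : ∀ i < t, Measurable fun ω => (x i ω, e i ω, u i ω)) :
    Measurable fun ω => history pol vstar (fun i => x i ω) (fun i => e i ω) (fun i => u i ω) t := by
  induction t with
  | zero => exact measurable_pi_lambda _ fun i => i.elim0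
  | succ t ih =>
    have ih := ih fun i hi => h i (by omega)
    refine measurable_pi_lambda _ fun i => ?_
    simp only [history_succ]
    refine Fin.lastCases ?_ (fun i => ?_) i
    · simp only [Fin.snoc_last]
      exact (measurable_outcome hpol hv t).comp (ih.prodMk (h t (by omega)))
    · simp only [Fin.snoc_castSucc]
      exact (measurable_pi_apply i).comp ih

/-- The history before round `t` is a function of the triples of rounds `i < t`, and the σ-algebra
these generate is independent of the triple of round `t`. -/
lemma indepFun_history {pol : Policy X} (hpol : MeasurablePolicy pol) {vstar : X → ℝ}
    (hv : Measurable vstar) [MeasurableSpace Ω] {μ : Measure Ω}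
    {PX : Measure X} {ν : Measure ℝ} {B : ℝ} {x : ℕ → Ω → X} {e u : ℕ → Ω → ℝ}
    (hm : IsMarket μ PX ν B x e u) (t : ℕ) :
    IndepFun (fun ω => history pol vstar (fun i => x i ω) (fun i => e i ω) (fun i => u i ω) t)
      (fun ω => (x t ω, e t ω, u t ω)) μ := by
  have hZ : ∀ i, Measurable fun ω => (x i ω, e i ω, u i ω) := fun i =>
    (hm.measurable_x i).prodMk ((hm.measurable_e i).prodMk (hm.measurable_u i))
  have h := indep_iSup_of_disjoint (fun i => (hZ i).comap_le) hm.indep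
    (S := {i | i < t}) (T := {t}) (by simp)
  rw [IndepFun_iff_Indep]
  refine indep_of_indep_of_le_left (indep_of_indep_of_le_right h ?_) ?_
  · exact le_iSup₂_of_le t rfl le_rfl
  · refine Measurable.comap_le ?_
    -- Measurability is applied with the σ-algebra of the earlier triples on `Ω`, not with the
    -- ambient one.
    refine measurable_history (m := ⨆ i ∈ {i | i < t}, _) hpol hv t fun i hi => ?_
    exact Measurable.mono (comap_measurable _) (le_iSup₂_of_le i hi le_rfl) le_rfl

end Measurability

/-! ### The sale indicator of a single round. -/

lemma isProbabilityMeasure_uniformPrice {B : ℝ} (hB : 0 < B) :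
    IsProbabilityMeasure (uniformPrice B) :=
  cond_isProbabilityMeasure_of_finite (by simp [hB]) (by simp)

/-- The deviation of the sale indicator of a round from its conditional mean. -/
noncomputable def excess {X : Type*} (F : ℝ → ℝ) (vstar : X → ℝ) (z : Rec X) : ℝ :=
  (if z.sale then (1 : ℝ) else 0) - (1 - F (z.price - vstar z.ctx))

/-- A sale is the closed event `p - v ≤ ε`, while revenue is written with `1 - F`. The two agree
because a Lipschitz distribution function leaves no atoms. -/
lemma measure_Ici_eq_of_cdf_lipschitz {ν : Measure ℝ} [IsProbabilityMeasure ν] {L : ℝ}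
    (hL : ∀ a b, |cdf ν a - cdf ν b| ≤ L * |a - b|) (c : ℝ) :
    ν.real (Set.Ici c) = 1 - cdf ν c := by
  have hc : Continuous (cdf ν) := by
    have : LipschitzWith (Real.toNNReal L) (cdf ν) := LipschitzWith.of_dist_le_mul fun a b => by
      rw [Real.dist_eq, Real.dist_eq]
      exact (hL a b).trans (mul_le_mul_of_nonneg_right (Real.le_coe_toNNReal L) (abs_nonneg _))
    exact this.continuous
  have hatom : ν {c} = 0 := by
    rw [← measure_cdf ν, StieltjesFunction.measure_singleton]
    have : Function.leftLim (cdf ν) c = cdf ν c :=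
      leftLim_eq_of_tendsto ((hc.tendsto c).mono_left nhdsWithin_le_nhds)
    simp [this]
  have h1 : ν.real (Set.Iic c) = cdf ν c := (cdf_eq_real ν c).symm
  have h2 : ν.real (Set.Ici c) = ν.real (Set.Ioi c) := by
    refine measureReal_congr ?_
    have : ∀ᵐ y ∂ν, y ≠ c := by simpa [ae_iff] using hatom
    filter_upwards [this] with y hy
    exact propext ⟨fun h => lt_of_le_of_ne h hy.symm, fun h => le_of_lt h⟩
  have h3 : (Set.Iic c)ᶜ = Set.Ioi c := Set.compl_Iic
  rw [h2, ← h3, probReal_compl_eq_one_sub measurableSet_Iic, h1]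

/-- Hoeffding's lemma for a variable in `[0, 1]`, whose variance proxy is `1/4`. The form with `l ^
2 / 8` moved to the left is one factor of a supermartingale. -/
lemma lintegral_exp_bernoulli_le {ν : Measure ℝ} [IsProbabilityMeasure ν] {c q : ℝ}
    (hq : ν.real (Set.Ici c) = q) (l : ℝ) :
    ∫⁻ y, ENNReal.ofReal (Real.exp (l * ((if c ≤ y then 1 else 0) - q) - l ^ 2 / 8)) ∂ν ≤ 1 := by
  have hm : Measurable fun y : ℝ => if c ≤ y then (1 : ℝ) else 0 :=
    Measurable.ite measurableSet_Ici measurable_const measurable_const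
  have hmean : ∫ y, (if c ≤ y then (1 : ℝ) else 0) ∂ν = q := by
    have : (fun y : ℝ => if c ≤ y then (1 : ℝ) else 0) = (Set.Ici c).indicator 1 := by
      ext y; simp [Set.indicator]
    rw [this, integral_indicator_one measurableSet_Ici, hq]
  have hs := hasSubgaussianMGF_of_mem_Icc (μ := ν) (a := 0) (b := 1) hm.aemeasurable
    (ae_of_all _ fun y => by split_ifs <;> simp)
  rw [hmean] at hs
  have h1 := hs.mgf_le l
  have h2 := hs.integrable_exp_mul l
  simp only [mgf] at h1
  have h3 : ∀ y : ℝ, ENNReal.ofReal (Real.exp (l * ((if c ≤ y then 1 else 0) - q) - l ^ 2 / 8))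
      = ENNReal.ofReal (Real.exp (-(l ^ 2 / 8))) *
        ENNReal.ofReal (Real.exp (l * ((if c ≤ y then 1 else 0) - q))) := fun y => by
    rw [← ENNReal.ofReal_mul (Real.exp_nonneg _), ← Real.exp_add]; congr 2; ring
  simp_rw [h3]
  rw [lintegral_const_mul' _ _ ENNReal.ofReal_ne_top,
    ← ofReal_integral_eq_lintegral_ofReal h2 (ae_of_all _ fun _ => Real.exp_nonneg _),
    ← ENNReal.ofReal_mul (Real.exp_nonneg _)]
  refine ENNReal.ofReal_le_one.2 ?_
  calc _ ≤ Real.exp (-(l ^ 2 / 8)) * _ := mul_le_mul_of_nonneg_left h1 (Real.exp_nonneg _)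
    _ = 1 := by
      rw [← Real.exp_add]
      simp
      ring

/-! ### Exponential supermartingales and validity of the confidence radii. -/

section Concentration

variable {X Ω : Type*}

/-- The exponent of the exponential supermartingale attached to arm `j` at layer `s`. -/
noncomputable def armExponent (F : ℝ → ℝ) (vstar : X → ℝ) (start s j : ℕ) (l : ℝ) {t : ℕ}
    (h : Fin t → Rec X) : ℝ :=
  ∑ τ ∈ armRounds start h s j, (l * excess F vstar (h τ) - l ^ 2 / 8)

lemma armExponent_snoc (F : ℝ → ℝ) (vstar : X → ℝ) (start s j : ℕ) (l : ℝ) {t : ℕ}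
    (h : Fin t → Rec X) (z : Rec X) :
    armExponent F vstar start s j l (Fin.snoc (α := fun _ => Rec X) h z) =
      armExponent F vstar start s j l h +
        if start ≤ t ∧ z.layer = s ∧ z.arm = j then l * excess F vstar z - l ^ 2 / 8 else 0 := by
  simp only [armExponent, armRounds, Finset.sum_filter]
  rw [Fin.sum_univ_castSucc]
  simp

variable [MeasurableSpace X]

lemma measurable_excess {F : ℝ → ℝ} (hF : Measurable F) {vstar : X → ℝ} (hv : Measurable vstar) :
    Measurable (excess F vstar) := by
  unfold excess Rec.sale Rec.price Rec.ctx
  refine Measurable.sub (Measurable.ite ?_ measurable_const measurable_const) (by fun_prop)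
  exact measurableSet_eq_fun (by fun_prop) measurable_const

lemma measurableSet_layer_arm (s j : ℕ) :
    MeasurableSet {z : Rec X | z.layer = s ∧ z.arm = j} := by
  unfold Rec.layer Rec.arm
  exact (measurableSet_eq_fun (by fun_prop) measurable_const).inter
    (measurableSet_eq_fun (by fun_prop) measurable_const)

lemma measurable_armExponent {F : ℝ → ℝ} (hF : Measurable F) {vstar : X → ℝ}
    (hv : Measurable vstar) (start s j : ℕ) (l : ℝ) (t : ℕ) :
    Measurable fun h : Fin t → Rec X => armExponent F vstar start s j l h := by
  simp only [armExponent, armRounds, Finset.sum_filter]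
  refine Finset.measurable_sum _ fun τ _ => ?_
  have he := measurable_excess hF hv
  refine Measurable.ite ?_ (by fun_prop) measurable_const
  exact (MeasurableSet.const _).inter ((measurableSet_layer_arm s j).preimage (measurable_pi_apply τ))

/-- Supermartingale argument by induction on `t`: given the past, the new round multiplies the
exponential by a factor of conditional mean at most `1`. If the round does not use arm `j` at layer
`s` in the phase, the factor is `1`; otherwise Hoeffding's lemma applies. -/
lemma lintegral_exp_armExponent_le {pol : Policy X} (hpol : MeasurablePolicy pol) {vstar : X → ℝ}
    (hv : Measurable vstar) [MeasurableSpace Ω] {μ : Measure Ω} [IsProbabilityMeasure μ]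
    {PX : Measure X} {ν : Measure ℝ} {B : ℝ} {x : ℕ → Ω → X} {e u : ℕ → Ω → ℝ}
    [IsProbabilityMeasure PX] [IsProbabilityMeasure ν] (hB : 0 < B)
    (hm : IsMarket μ PX ν B x e u) {L : ℝ} (hL : ∀ a b, |cdf ν a - cdf ν b| ≤ L * |a - b|)
    (start s j : ℕ) (l : ℝ) (t : ℕ) :
    ∫⁻ ω, ENNReal.ofReal (Real.exp (armExponent (cdf ν) vstar start s j l
      (history pol vstar (fun i => x i ω) (fun i => e i ω) (fun i => u i ω) t))) ∂μ ≤ 1 := by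
  have := isProbabilityMeasure_uniformPrice hB
  have hF : Measurable (cdf ν) := (monotone_cdf ν).measurable
  induction t with
  | zero => simp [armExponent, armRounds]
  | succ t ih =>
    have hZ : ∀ i, Measurable fun ω => (x i ω, e i ω, u i ω) := fun i =>
      (hm.measurable_x i).prodMk ((hm.measurable_e i).prodMk (hm.measurable_u i))
    have hH := measurable_history hpol hv t fun i _ => hZ i
    have hmap := (indepFun_iff_map_prod_eq_prod_map_map hH.aemeasurable (hZ t).aemeasurable).1
      (indepFun_history hpol hv hm t)
    rw [hm.law t] at hmap
    set Q := PX.prod (ν.prod (uniformPrice B))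
    set w : Rec X → ℝ := fun z =>
      if start ≤ t ∧ z.layer = s ∧ z.arm = j then l * excess (cdf ν) vstar z - l ^ 2 / 8 else 0
      with hw
    have hwm : Measurable w := by
      have he := measurable_excess hF hv
      exact Measurable.ite ((MeasurableSet.const _).inter (measurableSet_layer_arm s j))
        (by fun_prop) measurable_const
    have hom := measurable_outcome hpol hv t
    have ham := measurable_armExponent hF hv start s j l t
    set G : (Fin t → Rec X) × X × ℝ × ℝ → ℝ≥0∞ := fun z =>
      ENNReal.ofReal (Real.exp (armExponent (cdf ν) vstar start s j l z.1)) *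
        ENNReal.ofReal (Real.exp (w (outcome pol vstar t z))) with hG
    have hGm : Measurable G := by
      rw [hG]
      have := hwm.comp hom
      simp only [Function.comp_def] at this
      fun_prop
    have hinner : ∀ h : Fin t → Rec X,
        ∫⁻ z, ENNReal.ofReal (Real.exp (w (outcome pol vstar t (h, z)))) ∂Q ≤ 1 := fun h => by
      have hmz : Measurable fun z : X × ℝ × ℝ =>
          ENNReal.ofReal (Real.exp (w (outcome pol vstar t (h, z)))) :=
        (Real.measurable_exp.comp (hwm.comp (hom.comp measurable_prodMk_left))).ennreal_ofReal
      rw [lintegral_prod _ hmz.aemeasurable]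
      have hone : ∀ c, ∫⁻ p : ℝ × ℝ, ENNReal.ofReal
          (Real.exp (w (outcome pol vstar t (h, c, p)))) ∂(ν.prod (uniformPrice B)) ≤ 1 := fun c => by
        have hmc : Measurable fun p : ℝ × ℝ =>
            ENNReal.ofReal (Real.exp (w (outcome pol vstar t (h, c, p)))) :=
          hmz.comp measurable_prodMk_left
        -- The noise is integrated innermost: past, context and uniform draw fix the price, layer
        -- and arm, so only the sale indicator is still random.
        rw [lintegral_prod_symm _ hmc.aemeasurable]
        have hone : ∀ y, ∫⁻ r, ENNReal.ofReal
            (Real.exp (w (outcome pol vstar t (h, c, r, y)))) ∂ν ≤ 1 := fun y => by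
          by_cases hc : start ≤ t ∧ (pol t h c y).2.1 = s ∧ (pol t h c y).2.2 = j
          · have := lintegral_exp_bernoulli_le
              (measure_Ici_eq_of_cdf_lipschitz hL ((pol t h c y).1 - vstar c)) l
            refine le_trans (le_of_eq (lintegral_congr fun r => ?_)) this
            simp only [hw, outcome, Rec.layer, Rec.arm, if_pos hc, excess, Rec.sale, Rec.price,
              Rec.ctx, decide_eq_true_eq, sub_le_iff_le_add']
          · refine le_trans (le_of_eq (lintegral_congr (g := fun _ => 1) fun r => ?_)) (by simp)
            simp only [hw, outcome, Rec.layer, Rec.arm]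
            simp only [ENNReal.ofReal_eq_one, Real.exp_eq_one_iff]
            exact if_neg hc
        calc _ ≤ ∫⁻ _, 1 ∂(uniformPrice B) := lintegral_mono hone
          _ = 1 := by simp
      calc _ ≤ ∫⁻ _, 1 ∂PX := lintegral_mono hone
        _ = 1 := by simp
    calc _ = ∫⁻ ω, G (history pol vstar (fun i => x i ω) (fun i => e i ω) (fun i => u i ω) t,
          x t ω, e t ω, u t ω) ∂μ := by
          refine lintegral_congr fun ω => ?_
          rw [history_succ, armExponent_snoc, Real.exp_add, ENNReal.ofReal_mul (Real.exp_nonneg _)]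
          rfl
      _ = ∫⁻ z, G z ∂(Measure.map (fun ω => history pol vstar (fun i => x i ω) (fun i => e i ω)
            (fun i => u i ω) t) μ).prod Q := by
          rw [← hmap, lintegral_map hGm (hH.prodMk (hZ t))]
      _ = ∫⁻ h, ∫⁻ z, G (h, z) ∂Q ∂(Measure.map (fun ω => history pol vstar (fun i => x i ω)
            (fun i => e i ω) (fun i => u i ω) t) μ) := lintegral_prod _ hGm.aemeasurable
      _ ≤ ∫⁻ h, ENNReal.ofReal (Real.exp (armExponent (cdf ν) vstar start s j l h))
            ∂(Measure.map (fun ω => history pol vstar (fun i => x i ω)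
            (fun i => e i ω) (fun i => u i ω) t) μ) := by
          refine lintegral_mono fun h => ?_
          simp only [hG]
          rw [lintegral_const_mul' _ _ ENNReal.ofReal_ne_top]
          exact mul_le_of_le_one_right (zero_le) (hinner h)
      _ ≤ 1 := by
          rw [lintegral_map (by fun_prop) hH]
          exact ih

/-- Markov's inequality for the exponential of the arm exponent. -/
lemma measure_le_of_armExponent {pol : Policy X} (hpol : MeasurablePolicy pol) {vstar : X → ℝ}
    (hv : Measurable vstar) [MeasurableSpace Ω] {μ : Measure Ω} [IsProbabilityMeasure μ]
    {PX : Measure X} {ν : Measure ℝ} {B : ℝ} {x : ℕ → Ω → X} {e u : ℕ → Ω → ℝ}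
    [IsProbabilityMeasure PX] [IsProbabilityMeasure ν] (hB : 0 < B)
    (hm : IsMarket μ PX ν B x e u) {L : ℝ} (hL : ∀ a b, |cdf ν a - cdf ν b| ≤ L * |a - b|)
    (start s j : ℕ) (l : ℝ) (t : ℕ) (c : ℝ) :
    μ {ω | c ≤ armExponent (cdf ν) vstar start s j l
      (history pol vstar (fun i => x i ω) (fun i => e i ω) (fun i => u i ω) t)} ≤
      ENNReal.ofReal (Real.exp (-c)) := by
  have hF : Measurable (cdf ν) := (monotone_cdf ν).measurable
  have hZ : ∀ i, Measurable fun ω => (x i ω, e i ω, u i ω) := fun i =>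
      (hm.measurable_x i).prodMk ((hm.measurable_e i).prodMk (hm.measurable_u i))
  have hH := measurable_history hpol hv t fun i _ => hZ i
  have ham := (measurable_armExponent hF hv start s j l t).comp hH
  have h1 := lintegral_exp_armExponent_le hpol hv hB hm hL start s j l t
  have hc : ENNReal.ofReal (Real.exp c) ≠ 0 := by simp [Real.exp_pos]
  have h2 := meas_ge_le_lintegral_div (μ := μ)
    (Real.measurable_exp.comp ham).ennreal_ofReal.aemeasurable hc ENNReal.ofReal_ne_top
  refine le_trans (le_trans (measure_mono fun ω hω => ?_) h2) ?_
  · exact ENNReal.ofReal_le_ofReal (Real.exp_le_exp.2 hω)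
  · rw [Real.exp_neg, ENNReal.ofReal_inv_of_pos (Real.exp_pos _), ENNReal.div_eq_inv_mul]
    exact mul_le_of_le_one_right zero_le h1

/-- Hoeffding's inequality for one arm at one layer with a prescribed number of data. -/
lemma measure_arm_deviation_le {pol : Policy X} (hpol : MeasurablePolicy pol) {vstar : X → ℝ}
    (hv : Measurable vstar) [MeasurableSpace Ω] {μ : Measure Ω} [IsProbabilityMeasure μ]
    {PX : Measure X} {ν : Measure ℝ} {B : ℝ} {x : ℕ → Ω → X} {e u : ℕ → Ω → ℝ}
    [IsProbabilityMeasure PX] [IsProbabilityMeasure ν] (hB : 0 < B)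
    (hm : IsMarket μ PX ν B x e u) {L : ℝ} (hL : ∀ a b, |cdf ν a - cdf ν b| ≤ L * |a - b|)
    (start s j t m : ℕ) (hm0 : 0 < m) {Λ : ℝ} (hΛ : 0 ≤ Λ) :
    μ {ω | (armRounds start (history pol vstar (fun i => x i ω) (fun i => e i ω) (fun i => u i ω) t)
          s j).card = m ∧
        m * Real.sqrt (2 * Λ / m) < |∑ τ ∈ armRounds start (history pol vstar (fun i => x i ω)
          (fun i => e i ω) (fun i => u i ω) t) s j, excess (cdf ν) vstar
          (history pol vstar (fun i => x i ω) (fun i => e i ω) (fun i => u i ω) t τ)|} ≤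
      ENNReal.ofReal (2 * Real.exp (-(4 * Λ))) := by
  set r := Real.sqrt (2 * Λ / m) with hr
  have hmR : (0 : ℝ) < m := by exact_mod_cast hm0
  have hr0 : 0 ≤ r := Real.sqrt_nonneg _
  have hr2 : r ^ 2 * m = 2 * Λ := by
    rw [hr, Real.sq_sqrt (by positivity)]; field_simp
  -- The value `4 r` maximizes `l · m r - m l² / 8`, and the maximum is `2 m r² = 4 Λ`. The two
  -- signs of `l` give the two tails.
  have key : ∀ l : ℝ, l ^ 2 = (4 * r) ^ 2 → ∀ ω,
      (armRounds start (history pol vstar (fun i => x i ω) (fun i => e i ω) (fun i => u i ω) t)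
          s j).card = m → 4 * r * (m * r) ≤ l * ∑ τ ∈ armRounds start (history pol vstar
          (fun i => x i ω) (fun i => e i ω) (fun i => u i ω) t) s j, excess (cdf ν) vstar
          (history pol vstar (fun i => x i ω) (fun i => e i ω) (fun i => u i ω) t τ) →
      4 * Λ ≤ armExponent (cdf ν) vstar start s j l
        (history pol vstar (fun i => x i ω) (fun i => e i ω) (fun i => u i ω) t) := by
    intro l hl ω hcard hle
    rw [armExponent, Finset.sum_sub_distrib, ← Finset.mul_sum, Finset.sum_const, hcard, hl,
      nsmul_eq_mul]
    nlinarith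
  have h1 := measure_le_of_armExponent hpol hv hB hm hL start s j (4 * r) t (4 * Λ)
  have h2 := measure_le_of_armExponent hpol hv hB hm hL start s j (-(4 * r)) t (4 * Λ)
  rw [two_mul, ENNReal.ofReal_add (Real.exp_nonneg _) (Real.exp_nonneg _)]
  refine le_trans (measure_mono ?_) ((measure_union_le _ _).trans (add_le_add h1 h2))
  rintro ω ⟨hcard, hdev⟩
  rcases lt_abs.1 hdev with h | h
  · exact Or.inl (key _ rfl ω hcard (mul_le_mul_of_nonneg_left h.le (by positivity)))
  · refine Or.inr (key _ (by ring) ω hcard ?_)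
    rw [neg_mul, ← mul_neg]
    exact mul_le_mul_of_nonneg_left h.le (by positivity)

/-- With high probability the confidence radii are valid throughout a phase. -/
lemma measure_phase_deviation_le {pol : Policy X} (hpol : MeasurablePolicy pol) {vstar : X → ℝ}
    (hv : Measurable vstar) [MeasurableSpace Ω] {μ : Measure Ω} [IsProbabilityMeasure μ]
    {PX : Measure X} {ν : Measure ℝ} {B : ℝ} {x : ℕ → Ω → X} {e u : ℕ → Ω → ℝ}
    [IsProbabilityMeasure PX] [IsProbabilityMeasure ν] (hB : 0 < B)
    (hm : IsMarket μ PX ν B x e u) {L : ℝ} (hL : ∀ a b, |cdf ν a - cdf ν b| ≤ L * |a - b|)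
    (start S N n : ℕ) {δ : ℝ} (hδ : 0 < δ) (hδ1 : δ ≤ 1) :
    μ {ω | ∃ t ∈ Finset.Ico start (start + n), ∃ s ∈ Finset.Icc 1 S, ∃ j ∈ Finset.Icc 1 N,
        0 < (armRounds start (history pol vstar (fun i => x i ω) (fun i => e i ω)
          (fun i => u i ω) t) s j).card ∧
        (armRounds start (history pol vstar (fun i => x i ω) (fun i => e i ω)
          (fun i => u i ω) t) s j).card * Real.sqrt (2 * Real.log (2 * S * N * n / δ) /
            (armRounds start (history pol vstar (fun i => x i ω) (fun i => e i ω)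
              (fun i => u i ω) t) s j).card) <
        |∑ τ ∈ armRounds start (history pol vstar (fun i => x i ω)
          (fun i => e i ω) (fun i => u i ω) t) s j, excess (cdf ν) vstar
          (history pol vstar (fun i => x i ω) (fun i => e i ω) (fun i => u i ω) t τ)|} ≤
      ENNReal.ofReal δ := by
  by_cases h0 : S = 0 ∨ N = 0 ∨ n = 0
  · refine le_trans (le_of_eq ?_) (zero_le)
    convert measure_empty (μ := μ)
    ext ω
    simp only [Set.mem_ofPred_eq, Set.mem_empty_iff_false, iff_false]
    rintro ⟨t, ht, s, hs, j, hj, -⟩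
    simp only [Finset.mem_Ico, Finset.mem_Icc] at ht hs hj
    omega
  push Not at h0
  have hS : (1 : ℝ) ≤ S := by exact_mod_cast Nat.one_le_iff_ne_zero.2 h0.1
  have hN : (1 : ℝ) ≤ N := by exact_mod_cast Nat.one_le_iff_ne_zero.2 h0.2.1
  have hn : (1 : ℝ) ≤ n := by exact_mod_cast Nat.one_le_iff_ne_zero.2 h0.2.2
  set Y : ℝ := 2 * S * N * n with hY
  have hSN : 1 ≤ (S : ℝ) * N := one_le_mul_of_one_le_of_one_le hS hN
  have hSNn : 1 ≤ (S : ℝ) * N * n := one_le_mul_of_one_le_of_one_le hSN hn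
  have hY2 : 2 ≤ Y := by rw [hY]; nlinarith
  have hYδ : 1 ≤ Y / δ := by rw [le_div_iff₀ hδ]; linarith
  have hΛ : 0 ≤ Real.log (Y / δ) := Real.log_nonneg hYδ
  have hexp : Real.exp (-(4 * Real.log (Y / δ))) = (δ / Y) ^ 4 := by
    rw [← neg_mul, mul_comm, Real.exp_mul, Real.exp_log (by linarith)]
    have : (-4 : ℝ) = -((4 : ℕ) : ℝ) := by norm_num
    rw [this, Real.rpow_neg (by linarith), Real.rpow_natCast, ← inv_pow, inv_div]
  -- The last coordinate ranges over the possible sample sizes. The number of data is random, so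
  -- each value gets its own deviation bound.
  set I := Finset.Ico start (start + n) ×ˢ Finset.Icc 1 S ×ˢ Finset.Icc 1 N ×ˢ
    Finset.Icc 1 n with hI
  have hcardI : (I.card : ℝ) = n * (S * (N * n)) := by simp [hI]
  have hall : ∀ i ∈ I, μ {ω | (armRounds start (history pol vstar (fun i => x i ω)
          (fun i => e i ω) (fun i => u i ω) i.1) i.2.1 i.2.2.1).card = i.2.2.2 ∧
        i.2.2.2 * Real.sqrt (2 * Real.log (Y / δ) / i.2.2.2) < |∑ τ ∈ armRounds start (history pol vstar
          (fun i => x i ω) (fun i => e i ω) (fun i => u i ω) i.1) i.2.1 i.2.2.1, excess (cdf ν) vstar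
          (history pol vstar (fun i => x i ω) (fun i => e i ω) (fun i => u i ω) i.1 τ)|} ≤
      ENNReal.ofReal (2 * (δ / Y) ^ 4) := fun i hi => by
    rw [← hexp]
    simp only [hI, Finset.mem_product, Finset.mem_Icc] at hi
    exact measure_arm_deviation_le hpol hv hB hm hL start _ _ _ _ (by omega) hΛ
  have hsum := (measure_biUnion_finset_le I _).trans (Finset.sum_le_sum hall)
  rw [Finset.sum_const, nsmul_eq_mul, ← ENNReal.ofReal_natCast,
    ← ENNReal.ofReal_mul (by positivity), hcardI] at hsum
  refine le_trans (measure_mono ?_) (hsum.trans (ENNReal.ofReal_le_ofReal ?_))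
  · rintro ω ⟨t, ht, s, hs, j, hj, hpos, hdev⟩
    simp only [Set.mem_iUnion]
    refine ⟨(t, s, j, _), ?_, rfl, hdev⟩
    simp only [hI, Finset.mem_product]
    refine ⟨ht, hs, hj, Finset.mem_Icc.2 ⟨hpos, ?_⟩⟩
    simp only [Finset.mem_Ico] at ht
    have : armRounds start (history pol vstar (fun i => x i ω) (fun i => e i ω)
        (fun i => u i ω) t) s j ⊆ Finset.univ.filter fun τ : Fin t => start ≤ (τ : ℕ) := by
      intro τ hτ
      simp only [armRounds, Finset.mem_filter, Finset.mem_univ, true_and] at hτ ⊢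
      exact hτ.1
    refine (Finset.card_le_card this).trans ?_
    calc _ ≤ (Finset.Ico start t).card := by
          refine Finset.card_le_card_of_injOn (fun τ => (τ : ℕ)) (fun τ hτ => ?_)
            (fun a _ b _ h => Fin.ext h)
          have := τ.2
          simp at hτ ⊢
          omega
      _ ≤ n := by simp; omega
  · have hY0 : 0 < Y := by linarith
    have : n * (S * (N * n)) * (2 * (δ / Y) ^ 4) = δ * (δ ^ 3 * (n / Y) * (1 / Y ^ 2)) := by
      rw [hY]; field_simp
    rw [this]
    refine mul_le_of_le_one_right hδ.le ?_
    have a1 : δ ^ 3 ≤ 1 := pow_le_one₀ hδ.le hδ1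
    have a2 : n / Y ≤ 1 := by
      rw [div_le_one hY0, hY]; nlinarith
    have a3 : 1 / Y ^ 2 ≤ 1 := by rw [div_le_one (by positivity)]; nlinarith
    have a4 : 0 ≤ n / Y := by positivity
    exact mul_le_one₀ (mul_le_one₀ a1 a4 a2) (by positivity) a3

end Concentration

/-! ### Measurability of the pricing algorithm. -/

section PolicyMeasurability

variable {X Z β : Type*} [MeasurableSpace X] [MeasurableSpace Z] [MeasurableSpace β]

/-- Measurability of a random finite set of natural numbers. -/
def MeasurableFinset (f : Z → Finset ℕ) : Prop := ∀ A, MeasurableSet {z | f z = A}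

lemma MeasurableFinset.measurableSet {f : Z → Finset ℕ} (hf : MeasurableFinset f)
    (p : Finset ℕ → Prop) : MeasurableSet {z | p (f z)} := by
  have : {z | p (f z)} = ⋃ A ∈ {A | p A}, {z | f z = A} := by ext; simp
  rw [this]
  exact MeasurableSet.biUnion (Set.to_countable _) fun A _ => hf A

/-- There are only countably many finite subsets of `ℕ`, so a random set can be fixed on each piece
of a countable measurable partition. -/
lemma MeasurableFinset.measurable_apply {f : Z → Finset ℕ} (hf : MeasurableFinset f)
    {g : Finset ℕ → Z → β} (hg : ∀ A, Measurable (g A)) : Measurable fun z => g (f z) z := by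
  intro s hs
  have : (fun z => g (f z) z) ⁻¹' s = ⋃ A, {z | f z = A} ∩ g A ⁻¹' s := by
    ext z; simp
  rw [this]
  exact MeasurableSet.iUnion fun A => (hf A).inter (hg A hs)

lemma measurableFinset_filter (A : Finset ℕ) {p : Z → ℕ → Prop} [∀ z, DecidablePred (p z)]
    (hp : ∀ j, MeasurableSet {z | p z j}) : MeasurableFinset fun z => A.filter (p z) := by
  intro A'
  have : {z | A.filter (p z) = A'} = ⋂ j, {z | (j ∈ A ∧ p z j) ↔ j ∈ A'} := by
    ext z; simp [Finset.ext_iff]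
  rw [this]
  refine MeasurableSet.iInter fun j => ?_
  by_cases h1 : j ∈ A <;> by_cases h2 : j ∈ A' <;> simp only [h1, h2, true_and, false_and, iff_true,
    iff_false]
  · exact hp j
  · exact (hp j).compl
  · exact MeasurableSet.const _
  · exact MeasurableSet.const _

lemma measurable_sum_armRounds {t : ℕ} (start s j : ℕ) {g : Rec X → ℝ} (hg : Measurable g) :
    Measurable fun h : Fin t → Rec X => ∑ τ ∈ armRounds start h s j, g (h τ) := by
  simp only [armRounds, Finset.sum_filter]
  refine Finset.measurable_sum _ fun τ _ => Measurable.ite ?_ (by fun_prop) measurable_const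
  exact (MeasurableSet.const _).inter ((measurableSet_layer_arm s j).preimage (measurable_pi_apply τ))

lemma measurable_card_armRounds {t : ℕ} (start s j : ℕ) :
    Measurable fun h : Fin t → Rec X => ((armRounds start h s j).card : ℝ) := by
  simpa using measurable_sum_armRounds (t := t) start s j (X := X) (measurable_const (a := (1 : ℝ)))

lemma measurable_sampleMean {t : ℕ} (start s j : ℕ) :
    Measurable fun h : Fin t → Rec X => sampleMean start h s j := by
  unfold sampleMean
  refine Measurable.div ?_ (measurable_card_armRounds start s j)
  refine measurable_sum_armRounds start s j (g := fun z => if z.sale then (1 : ℝ) else 0) ?_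
  refine Measurable.ite ?_ measurable_const measurable_const
  unfold Rec.sale
  exact measurableSet_eq_fun (by fun_prop) measurable_const

lemma measurable_radius {t : ℕ} (start N n : ℕ) (δ : ℝ) (s j : ℕ) :
    Measurable fun h : Fin t → Rec X => radius start N n δ h s j := by
  have h := measurable_card_armRounds (X := X) (t := t) start s j
  unfold radius
  refine Measurable.ite ?_ measurable_const (by fun_prop)
  have : {h : Fin t → Rec X | (armRounds start h s j).card = 0} =
      {h | ((armRounds start h s j).card : ℝ) = 0} := by ext; simp
  rw [this]
  exact measurableSet_eq_fun h measurable_const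

variable {t : ℕ} {v : Z → X → ℝ} {h : Z → Fin t → Rec X} {x : Z → X}

omit [MeasurableSpace X] in
lemma measurable_armPrice (B : ℝ) (hv : Measurable fun z => v z (x z))
    (hs : Measurable fun z => supNorm (v z)) (N j : ℕ) :
    Measurable fun z => armPrice B (v z) N (x z) j := by
  exact (hs.neg.add (((hs.const_mul 2).const_add B |>.div_const _).const_mul _)).add hv

lemma measurable_ucb (B δ : ℝ) (start N n s j : ℕ) (hv : Measurable fun z => v z (x z))
    (hs : Measurable fun z => supNorm (v z)) (hh : Measurable h) :
    Measurable fun z => ucb start N n B δ (v z) (h z) (x z) s j := by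
  unfold ucb
  exact (measurable_armPrice B hv hs N j).mul
    (((measurable_sampleMean start s j).comp hh).add ((measurable_radius start N n δ s j).comp hh))

/-- The action set is deterministic in the statement. The random survivors of a layer are
substituted through `MeasurableFinset.measurable_apply`, which lets the induction go through. -/
lemma measurable_traverse (B δ : ℝ) (start N n : ℕ) (hv : Measurable fun z => v z (x z))
    (hs : Measurable fun z => supNorm (v z)) (hh : Measurable h) {pick : Z → Finset ℕ → ℕ}
    (hp : ∀ A, Measurable fun z => pick z A) (fuel : ℕ) : ∀ (s : ℕ) (A : Finset ℕ),
    Measurable fun z => traverse start N n B δ (v z) (h z) (x z) (pick z) fuel s A := by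
  classical
  have hu := fun s j => measurable_ucb B δ start N n s j hv hs hh
  induction fuel with
  | zero =>
    intro s A
    simp only [traverse]
    refine measurable_const.prodMk (MeasurableFinset.measurable_apply ?_ hp)
    unfold bestArms
    refine measurableFinset_filter A fun j => ?_
    have : {z | ∀ i ∈ A, ucb start N n B δ (v z) (h z) (x z) s i ≤
        ucb start N n B δ (v z) (h z) (x z) s j} = ⋂ i ∈ A,
        {z | ucb start N n B δ (v z) (h z) (x z) s i ≤
          ucb start N n B δ (v z) (h z) (x z) s j} := by ext; simp
    rw [this]
    exact Finset.measurableSet_biInter _ fun i _ => measurableSet_le (hu s i) (hu s j)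
  | succ fuel ih =>
    intro s A
    simp only [traverse]
    have hfail : MeasurableFinset fun z => failingArms start N n B δ (v z) (h z) (x z) s A := by
      unfold failingArms
      refine measurableFinset_filter A fun j => measurableSet_lt measurable_const ?_
      exact (measurable_armPrice B hv hs N j).mul ((measurable_radius start N n δ s j).comp hh)
    have hsurv : MeasurableFinset fun z => survivingArms start N n B δ (v z) (h z) (x z) s A := by
      unfold survivingArms
      refine measurableFinset_filter A fun j => ?_
      have : {z | ∀ i ∈ A, ucb start N n B δ (v z) (h z) (x z) s i - B * (2 : ℝ) ^ (1 - (s : ℤ)) ≤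
          ucb start N n B δ (v z) (h z) (x z) s j} = ⋂ i ∈ A,
          {z | ucb start N n B δ (v z) (h z) (x z) s i - B * (2 : ℝ) ^ (1 - (s : ℤ)) ≤
            ucb start N n B δ (v z) (h z) (x z) s j} := by ext; simp
      rw [this]
      exact Finset.measurableSet_biInter _ fun i _ =>
        measurableSet_le ((hu s i).sub measurable_const) (hu s j)
    refine Measurable.ite (hfail.measurableSet _) ?_ ?_
    · exact measurable_const.prodMk (hfail.measurable_apply hp)
    · exact hsurv.measurable_apply (g := fun A z => traverse start N n B δ (v z) (h z) (x z) (pick z)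
        fuel (s + 1) A) (ih (s + 1))

lemma measurable_ucbRound (B δ : ℝ) (start N n : ℕ) (hv : Measurable fun z => v z (x z))
    (hs : Measurable fun z => supNorm (v z)) (hh : Measurable h) {pick : Z → Finset ℕ → ℕ}
    (hp : ∀ A, Measurable fun z => pick z A) {u : Z → ℝ} (hu : Measurable u) :
    Measurable fun z => ucbRound start N n B δ (v z) (h z) (x z) (pick z) (u z) := by
  classical
  have hinit : MeasurableFinset fun z => initialArms B (v z) N (x z) := by
    unfold initialArms
    refine measurableFinset_filter _ fun j => ?_
    have := measurable_armPrice B hv hs N j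
    exact (measurableSet_lt measurable_const this).inter (measurableSet_lt this measurable_const)
  have htr : Measurable fun z => traverse start N n B δ (v z) (h z) (x z) (pick z)
      (numLayers n - 1) 1 (initialArms B (v z) N (x z)) :=
    hinit.measurable_apply (g := fun A z => traverse start N n B δ (v z) (h z) (x z) (pick z)
      (numLayers n - 1) 1 A) (measurable_traverse B δ start N n hv hs hh hp _ 1)
  unfold ucbRound
  refine Measurable.ite (hinit.measurableSet _) ?_ (hu.prodMk measurable_const)
  refine Measurable.prodMk ?_ (htr.fst.prodMk htr.snd)
  have hj := fun j => measurable_armPrice B hv hs N j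
  have : Measurable fun p : ℕ × Z => armPrice B (v p.2) N (x p.2) p.1 :=
    measurable_from_prod_countable_right fun j => hj j
  exact this.comp (htr.snd.prodMk measurable_id)

lemma measurablePolicy_pricingAlgorithm (B ρ δ : ℝ) (Te : ℕ → ℕ) {orc : Oracle X}
    (horc : MeasurableOracle orc) {sel : Selector X} (hsel : AdmissibleSelector sel) :
    MeasurablePolicy (pricingAlgorithm B ρ δ Te orc sel) := by
  intro t
  unfold pricingAlgorithm
  simp only
  split_ifs with h1 h2
  · fun_prop
  · generalize episodeOf t = k at h2 ⊢
    have hsm : Measurable fun z : (Fin t → Rec X) × X × ℝ =>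
        samples z.1 (episodeLength k) (Te k) h2 := by
      refine measurable_pi_lambda _ fun i => ?_
      simp only [samples, Rec.ctx, Rec.sale]
      fun_prop
    have hx : Measurable fun z : (Fin t → Rec X) × X × ℝ => z.2.1 := by fun_prop
    have hv : Measurable fun z : (Fin t → Rec X) × X × ℝ =>
        orc (Te k) (samples z.1 (episodeLength k) (Te k) h2) z.2.1 :=
      (horc (Te k)).1.comp (hsm.prodMk hx)
    have hs : Measurable fun z : (Fin t → Rec X) × X × ℝ =>
        supNorm (orc (Te k) (samples z.1 (episodeLength k) (Te k) h2)) := (horc (Te k)).2.comp hsm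
    have hp : ∀ A, Measurable fun z : (Fin t → Rec X) × X × ℝ => sel t z.1 z.2.1 A := fun A =>
      (hsel.2 t A).comp (f := fun z : (Fin t → Rec X) × X × ℝ => (z.1, z.2.1)) (by fun_prop)
    have hu : Measurable fun z : (Fin t → Rec X) × X × ℝ => z.2.2 := by fun_prop
    have hh : Measurable fun z : (Fin t → Rec X) × X × ℝ => z.1 := measurable_fst
    exact measurable_ucbRound B δ _ _ _ hv hs hh hp hu
  · fun_prop

end PolicyMeasurability

/-! ### Episode indexing. -/

lemma two_mul_episodeLength {k : ℕ} (hk : 1 ≤ k) : 2 * episodeLength k = 2 ^ k := by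
  obtain ⟨k, rfl⟩ := Nat.exists_eq_add_of_le' hk
  simp [episodeLength, pow_succ, mul_comm]

lemma episodeLength_pos (k : ℕ) : 0 < episodeLength k := by simp [episodeLength]

lemma episodeOf_eq {k t : ℕ} (hk : 1 ≤ k) (h1 : episodeLength k ≤ t)
    (h2 : t < 2 * episodeLength k) : episodeOf t = k := by
  rw [two_mul_episodeLength hk] at h2
  have : Nat.log 2 t = k - 1 := by
    refine (Nat.log_eq_iff (Or.inr ⟨by norm_num, ?_⟩)).2 ⟨h1, ?_⟩
    · have := episodeLength_pos k; omega
    · rwa [Nat.sub_add_cancel hk]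
  rw [episodeOf, this]; omega

lemma explorationLength_le (ρ α : ℝ) (k : ℕ) : explorationLength ρ α k ≤ episodeLength k :=
  min_le_right _ _

/-! ### Exploration data: independence, moment condition, accuracy of the oracle. -/

section Exploration

variable {X Ω : Type*}

lemma roundRec_of_exploration {B ρ δ : ℝ} {Te : ℕ → ℕ} {orc : Oracle X} {sel : Selector X}
    (vstar : X → ℝ) (x : ℕ → X) (e u : ℕ → ℝ) {k t : ℕ} (hk : 1 ≤ k)
    (hTe : Te k ≤ episodeLength k) (h1 : episodeLength k ≤ t) (h2 : t < episodeLength k + Te k) :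
    roundRec (pricingAlgorithm B ρ δ Te orc sel) vstar x e u t =
      (x t, u t, decide (u t ≤ vstar (x t) + e t), 0, 0) := by
  have hep : episodeOf t = k := episodeOf_eq hk h1 (by omega)
  have : pricingAlgorithm B ρ δ Te orc sel t
      (history (pricingAlgorithm B ρ δ Te orc sel) vstar x e u t) (x t) (u t) = (u t, 0, 0) := by
    conv_lhs => unfold pricingAlgorithm
    simp only [hep]
    split_ifs with h
    · rfl
    · omega
    · rfl
  simp only [roundRec, this]

/-- The right-hand side involves only the market variables, not the policy. This is what makes the
regression data i.i.d. although they are read from an adaptive history. -/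
lemma samples_history {B ρ δ : ℝ} {Te : ℕ → ℕ} {orc : Oracle X} {sel : Selector X}
    (vstar : X → ℝ) (x : ℕ → X) (e u : ℕ → ℝ) {k t : ℕ} (hk : 1 ≤ k)
    (hTe : Te k ≤ episodeLength k) (ht : episodeLength k + Te k ≤ t) :
    samples (history (pricingAlgorithm B ρ δ Te orc sel) vstar x e u t) (episodeLength k) (Te k) ht =
      fun i : Fin (Te k) => (x (episodeLength k + i), decide (u (episodeLength k + i) ≤
        vstar (x (episodeLength k + i)) + e (episodeLength k + i))) := by
  ext1 i
  simp only [samples, history_apply]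
  rw [roundRec_of_exploration vstar x e u hk hTe (by omega) (by omega)]
  rfl

variable [MeasurableSpace X]

lemma measurable_exploration {vstar : X → ℝ} (hv : Measurable vstar) :
    Measurable fun z : X × ℝ × ℝ => (z.1, decide (z.2.2 ≤ vstar z.1 + z.2.1)) :=
  measurable_fst.prodMk (measurable_decide_le (by fun_prop) (by fun_prop))

lemma map_exploration_eq_pi [MeasurableSpace Ω] {μ : Measure Ω} [IsProbabilityMeasure μ]
    {PX : Measure X} {ν : Measure ℝ} {B : ℝ} {x : ℕ → Ω → X} {e u : ℕ → Ω → ℝ}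
    (hm : IsMarket μ PX ν B x e u) {vstar : X → ℝ} (hv : Measurable vstar) (a n : ℕ) :
    μ.map (fun ω (i : Fin n) => (x (a + i) ω,
      decide (u (a + i) ω ≤ vstar (x (a + i) ω) + e (a + i) ω))) =
      Measure.pi fun _ : Fin n => explorationLaw PX ν B vstar := by
  have hZ : ∀ i, Measurable fun ω => (x i ω, e i ω, u i ω) := fun i =>
    (hm.measurable_x i).prodMk ((hm.measurable_e i).prodMk (hm.measurable_u i))
  have hf := measurable_exploration hv
  have h1 := (hm.indep.comp (fun _ => fun z : X × ℝ × ℝ => (z.1, decide (z.2.2 ≤ vstar z.1 + z.2.1)))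
    fun _ => hf).precomp (g := fun i : Fin n => a + i) (fun i j h => Fin.ext (by simpa using h))
  have h2 := (iIndepFun_iff_map_fun_eq_pi_map
    (fun i : Fin n => (hf.comp (hZ (a + i))).aemeasurable)).1 h1
  refine h2.trans ?_
  congr 1
  ext1 i
  rw [← Measure.map_map hf (hZ _), hm.law]
  rfl

lemma uniformPrice_real_Iic {B w : ℝ} (hB : 0 < B) (h0 : 0 ≤ w) (h1 : w ≤ B) :
    (uniformPrice B).real (Set.Iic w) = w / B := by
  have : volume.real (Set.Ioo 0 B ∩ Set.Iic w) = w := by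
    rcases h1.lt_or_eq with h | rfl
    · have : Set.Ioo 0 B ∩ Set.Iic w = Set.Ioc 0 w := by
        ext y; simp only [Set.mem_inter_iff, Set.mem_Ioo, Set.mem_Iic, Set.mem_Ioc]
        constructor
        · rintro ⟨⟨a, b⟩, c⟩; exact ⟨a, c⟩
        · rintro ⟨a, b⟩; exact ⟨⟨a, by linarith⟩, b⟩
      simp [this, h0]
    · have : Set.Ioo 0 w ∩ Set.Iic w = Set.Ioo 0 w :=
        Set.inter_eq_left.2 fun y hy => hy.2.le
      simp [this, h0]
  rw [uniformPrice, Measure.real, cond_apply measurableSet_Ioo, ENNReal.toReal_mul,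
    ENNReal.toReal_inv]
  change (volume.real _)⁻¹ * volume.real _ = _
  rw [this]
  simp [hB.le, div_eq_inv_mul]

/-- Bounded noise keeps `c + ε` in `[0, B]`, so a uniform price lies below it with probability
exactly `(c + ε) / B`. Multiplying by `B` and averaging the centred noise leaves `c`. -/
lemma integral_sale_uniformPrice {ν : Measure ℝ} [IsProbabilityMeasure ν] {B Bε c : ℝ} (hB : 0 < B)
    (hmean : ∫ z, z ∂ν = 0) (hbd : ∀ᵐ z ∂ν, |z| ≤ Bε) (hc : c ∈ Set.Icc Bε (B - Bε)) :
    ∫ p : ℝ × ℝ, B * (if decide (p.2 ≤ c + p.1) = true then (1 : ℝ) else 0)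
      ∂(ν.prod (uniformPrice B)) = c := by
  have := isProbabilityMeasure_uniformPrice hB
  have hmeas : Measurable fun p : ℝ × ℝ =>
      B * (if decide (p.2 ≤ c + p.1) = true then (1 : ℝ) else 0) := by
    simp only [decide_eq_true_eq]
    exact (Measurable.ite (measurableSet_le (by fun_prop) (by fun_prop)) measurable_const
      measurable_const).const_mul B
  have hint : Integrable (fun p : ℝ × ℝ =>
      B * (if decide (p.2 ≤ c + p.1) = true then (1 : ℝ) else 0)) (ν.prod (uniformPrice B)) := by
    refine Integrable.of_bound hmeas.aestronglyMeasurable B (ae_of_all _ fun p => ?_)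
    split_ifs <;> simp [abs_of_pos hB, hB.le]
  rw [integral_prod _ hint]
  have hid : Integrable (fun z : ℝ => z) ν :=
    Integrable.of_bound measurable_id.aestronglyMeasurable Bε (by simpa using hbd)
  have : (fun z => ∫ y, B * (if decide (y ≤ c + z) = true then (1 : ℝ) else 0) ∂(uniformPrice B))
      =ᵐ[ν] fun z => c + z := by
    filter_upwards [hbd] with z hz
    have hind : (fun y : ℝ => if decide (y ≤ c + z) = true then (1 : ℝ) else 0) =
        (Set.Iic (c + z)).indicator 1 := by
      ext y; simp [Set.indicator]
    rw [integral_const_mul, hind, integral_indicator_one measurableSet_Iic,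
      uniformPrice_real_Iic hB]
    · field_simp
    · linarith [hc.1, neg_le_of_abs_le hz]
    · linarith [hc.2, le_of_abs_le hz]
  rw [integral_congr_ae this, integral_add (integrable_const _) hid, hmean]
  simp

/-- Conditional expectation is checked on cylinders `s' × Bool`. Fubini reduces it to the identity
at a fixed context. -/
lemma momentCondition_explorationLaw {PX : Measure X} [IsProbabilityMeasure PX] {ν : Measure ℝ}
    [IsProbabilityMeasure ν] {B Bε : ℝ} (hB : 0 < B) {vstar : X → ℝ} (hv : Measurable vstar)
    (hmean : ∫ z, z ∂ν = 0) (hbd : ∀ᵐ z ∂ν, |z| ≤ Bε)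
    (hrange : ∀ z, vstar z ∈ Set.Icc Bε (B - Bε)) :
    MomentCondition B vstar (explorationLaw PX ν B vstar) := by
  have := isProbabilityMeasure_uniformPrice hB
  have hf := measurable_exploration hv
  have : IsProbabilityMeasure (explorationLaw PX ν B vstar) :=
    Measure.isProbabilityMeasure_map hf.aemeasurable
  have hgm : Measurable fun z : X × Bool => B * (if z.2 then (1 : ℝ) else 0) :=
    (Measurable.ite (measurableSet_eq_fun (by fun_prop) measurable_const) measurable_const
      measurable_const).const_mul B
  have hgb : ∀ z : X × Bool, ‖B * (if z.2 then (1 : ℝ) else 0)‖ ≤ B := fun z => by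
    split_ifs <;> simp [abs_of_pos hB, hB.le]
  have hle : MeasurableSpace.comap (Prod.fst : X × Bool → X) inferInstance ≤
      (inferInstance : MeasurableSpace (X × Bool)) := measurable_fst.comap_le
  have hv1 : Measurable fun z : X × Bool => vstar z.1 := hv.comp measurable_fst
  have hvb : ∀ z : X, ‖vstar z‖ ≤ |Bε| + |B - Bε| := fun z => by
    have h := hrange z
    rw [Real.norm_eq_abs]
    exact abs_le.2 ⟨by linarith [h.1, neg_abs_le Bε, abs_nonneg (B - Bε)],
      by linarith [h.2, le_abs_self (B - Bε), abs_nonneg Bε]⟩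
  refine (ae_eq_condExp_of_forall_setIntegral_eq hle
    (Integrable.of_bound hgm.aestronglyMeasurable B (ae_of_all _ hgb)) (fun s _ _ => ?_)
    (fun s hs _ => ?_) ?_).symm
  · exact (Integrable.of_bound hv1.aestronglyMeasurable _ (ae_of_all _ fun z => hvb z.1)).integrableOn
  · obtain ⟨s', hs', rfl⟩ := hs
    have hpre : MeasurableSet (Prod.fst ⁻¹' s' : Set (X × Bool)) := measurable_fst hs'
    unfold explorationLaw
    rw [setIntegral_map hpre hv1.aestronglyMeasurable hf.aemeasurable,
      setIntegral_map hpre hgm.aestronglyMeasurable hf.aemeasurable]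
    have hset : (fun z : X × ℝ × ℝ => (z.1, decide (z.2.2 ≤ vstar z.1 + z.2.1))) ⁻¹'
        (Prod.fst ⁻¹' s') = s' ×ˢ Set.univ := by ext; simp
    rw [hset, setIntegral_prod, setIntegral_prod]
    · refine setIntegral_congr_fun hs' fun c _ => ?_
      simp only [Measure.restrict_univ]
      rw [integral_sale_uniformPrice hB hmean hbd (hrange c)]
      simp
    · refine (Integrable.of_bound (hgm.comp hf).aestronglyMeasurable B
        (ae_of_all _ fun z => hgb _)).integrableOn
    · refine (Integrable.of_bound (hv1.comp hf).aestronglyMeasurable _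
        (ae_of_all _ fun z => hvb z.1)).integrableOn
  · refine (Measurable.stronglyMeasurable ?_).aestronglyMeasurable
    exact hv.comp (comap_measurable Prod.fst)

/-- The oracle is accurate on the exploration data of an episode with probability `1 - δ`. -/
lemma measure_oracle_error_le [MeasurableSpace Ω] {μ : Measure Ω} [IsProbabilityMeasure μ]
    {PX : Measure X} [IsProbabilityMeasure PX] {ν : Measure ℝ} [IsProbabilityMeasure ν]
    {B Bε ρ α δ : ℝ} (hB : 0 < B) {x : ℕ → Ω → X} {e u : ℕ → Ω → ℝ}
    (hm : IsMarket μ PX ν B x e u) {vstar : X → ℝ} (hv : Measurable vstar)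
    (hmean : ∫ z, z ∂ν = 0) (hbd : ∀ᵐ z ∂ν, |z| ≤ Bε)
    (hrange : ∀ z, vstar z ∈ Set.Icc Bε (B - Bε)) {V : Set (X → ℝ)} {orc : Oracle X}
    (horc : IsGeneralOfflineOracle V B vstar ρ α δ (explorationLaw PX ν B vstar) orc)
    (a n : ℕ) (hn : 0 < n) :
    μ {ω | ¬ ∀ y, |orc n (fun i : Fin n => (x (a + i) ω,
      decide (u (a + i) ω ≤ vstar (x (a + i) ω) + e (a + i) ω))) y - vstar y| ≤
        Real.sqrt (ρ / (n : ℝ) ^ α)} ≤ ENNReal.ofReal δ := by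
  have h := horc.2 (momentCondition_explorationLaw hB hv hmean hbd hrange) n hn
  rw [← map_exploration_eq_pi hm hv a n] at h
  have hZ : ∀ i, Measurable fun ω => (x i ω, e i ω, u i ω) := fun i =>
    (hm.measurable_x i).prodMk ((hm.measurable_e i).prodMk (hm.measurable_u i))
  -- The failure event quantifies over all contexts and need not be measurable; this inequality for
  -- push-forwards holds for every set.
  refine le_trans (Measure.le_map_apply ?_ _) h
  refine (measurable_pi_lambda _ fun i : Fin n => ?_).aemeasurable
  exact (measurable_exploration hv).comp (hZ (a + i))

end Exploration

/-! ### The layer traversal, the price grid and the bias of the confidence bounds. -/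

section Traversal

variable {X : Type*} {t : ℕ}

/-- If all upper confidence bounds on the layers up to `S` are valid up to the bias `b`, then the
traversal keeps a nearly optimal arm in every layer, and the suboptimality of the arms that reach
layer `s` is of order `B * 2 ^ (-s)`. -/
lemma traverse_spec {start N n : ℕ} {B δ : ℝ} {v : X → ℝ} {h : Fin t → Rec X} {x : X}
    {pick : Finset ℕ → ℕ} (hpick : ∀ A : Finset ℕ, A.Nonempty → pick A ∈ A) {R : ℕ → ℝ}
    {b Rs : ℝ} {S : ℕ} {A₀ : Finset ℕ} (hb : 0 ≤ b) (hB : 0 < B)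
    (hlow : ∀ s ∈ Finset.Icc 1 S, ∀ j ∈ A₀, R j - b ≤ ucb start N n B δ v h x s j)
    (hup : ∀ s ∈ Finset.Icc 1 S, ∀ j ∈ A₀, ucb start N n B δ v h x s j ≤
      R j + 2 * (armPrice B v N x j * radius start N n δ h s j) + b) (fuel : ℕ) :
    ∀ (s : ℕ) (A : Finset ℕ), 1 ≤ s → s + fuel ≤ S → A ⊆ A₀ →
      (∃ i ∈ A, Rs ≤ R i + 2 * b * (s - 1)) →
      (∀ j ∈ A, Rs ≤ R j + 8 * (B * (2 : ℝ) ^ (-(s : ℤ))) + 2 * b * s) →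
      let a := traverse start N n B δ v h x pick fuel s A
      s ≤ a.1 ∧ a.1 ≤ s + fuel ∧ a.2 ∈ A ∧
        (a.1 < s + fuel → B * (2 : ℝ) ^ (-(a.1 : ℤ)) <
          armPrice B v N x a.2 * radius start N n δ h a.1 a.2) ∧
        Rs ≤ R a.2 + 8 * (B * (2 : ℝ) ^ (-(a.1 : ℤ))) + 2 * b * a.1 := by
  classical
  induction fuel with
  | zero =>
    intro s A hs hsS hA hex hall
    have hne : A.Nonempty := let ⟨i, hi, _⟩ := hex; ⟨i, hi⟩
    have hbest : (bestArms start N n B δ v h x s A).Nonempty := by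
      obtain ⟨i, hi, hmax⟩ := A.exists_max_image (ucb start N n B δ v h x s) hne
      exact ⟨i, by simp only [bestArms, Finset.mem_filter]; exact ⟨hi, hmax⟩⟩
    have hmem : pick (bestArms start N n B δ v h x s A) ∈ A :=
      Finset.filter_subset _ _ (hpick _ hbest)
    exact ⟨le_rfl, le_rfl, hmem, fun h => absurd h (lt_irrefl _), hall _ hmem⟩
  | succ fuel ih =>
    intro s A hs hsS hA hex hall
    have hne : A.Nonempty := let ⟨i, hi, _⟩ := hex; ⟨i, hi⟩
    simp only [traverse]
    split_ifs with hf
    · have hmem := hpick _ hf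
      simp only [failingArms, Finset.mem_filter] at hmem
      exact ⟨le_rfl, by omega, hmem.1, fun _ => hmem.2, hall _ hmem.1⟩
    · have hsI : s ∈ Finset.Icc 1 S := Finset.mem_Icc.2 ⟨hs, by omega⟩
      have hprec : ∀ j ∈ A, armPrice B v N x j * radius start N n δ h s j ≤
          B * (2 : ℝ) ^ (-(s : ℤ)) := fun j hj => by
        by_contra hlt
        exact hf ⟨j, by simp only [failingArms, Finset.mem_filter]; exact ⟨hj, not_le.1 hlt⟩⟩
      have hz1 : (2 : ℝ) ^ (1 - (s : ℤ)) = 2 * (2 : ℝ) ^ (-(s : ℤ)) := by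
        rw [sub_eq_add_neg, zpow_add₀ (by norm_num), zpow_one]
      have hz2 : (2 : ℝ) ^ (-((s + 1 : ℕ) : ℤ)) = (2 : ℝ) ^ (-(s : ℤ)) / 2 := by
        push_cast
        rw [neg_add, zpow_add₀ (by norm_num)]
        norm_num
        ring
      set q := (2 : ℝ) ^ (-(s : ℤ)) with hq
      obtain ⟨i, hi, hRi⟩ := hex
      have hsurv : ∀ j, j ∈ survivingArms start N n B δ v h x s A ↔ j ∈ A ∧ ∀ i ∈ A,
          ucb start N n B δ v h x s i - B * (2 * q) ≤ ucb start N n B δ v h x s j := fun j => by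
        simp only [survivingArms, Finset.mem_filter, hz1]
      have hcast : ((s + 1 : ℕ) : ℝ) = s + 1 := by push_cast; ring
      have hBq : 0 ≤ B * q := by positivity
      -- If the near-optimal arm `i` is eliminated, the maximizer `m` of the upper confidence bound
      -- takes its place. Elimination gives `ucb i < ucb m - 2 B q`, and the precision check gives
      -- `ucb m ≤ R m + 2 B q + b`, so the replacement costs at most `2 b`.
      have hex' : ∃ i ∈ survivingArms start N n B δ v h x s A,
          Rs ≤ R i + 2 * b * ((s + 1 : ℕ) - 1) := by
        rw [hcast]
        by_cases hiS : i ∈ survivingArms start N n B δ v h x s A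
        · exact ⟨i, hiS, by nlinarith⟩
        · obtain ⟨m, hm, hmax⟩ := A.exists_max_image (ucb start N n B δ v h x s) hne
          have hout : ∃ i' ∈ A, ucb start N n B δ v h x s i <
              ucb start N n B δ v h x s i' - B * (2 * q) := by
            by_contra hcon
            push Not at hcon
            exact hiS ((hsurv i).2 ⟨hi, hcon⟩)
          obtain ⟨i', hi', hlt⟩ := hout
          have h1 := hmax i' hi'
          have h2 := hlow s hsI i (hA hi)
          have h3 := hup s hsI m (hA hm)
          have h4 := hprec m hm
          by_cases hmS : m ∈ survivingArms start N n B δ v h x s A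
          · exact ⟨m, hmS, by linarith⟩
          · exfalso
            refine hmS ((hsurv m).2 ⟨hm, fun l hl => ?_⟩)
            have h5 := hmax l hl
            have h6 := hmax i hi
            linarith
      -- The survival slack `2 B q` and the width `2 B q` of the confidence bound add up to `4 B q`,
      -- which is `8 B 2 ^ (-(s + 1))`.
      have hall' : ∀ j ∈ survivingArms start N n B δ v h x s A,
          Rs ≤ R j + 8 * (B * (2 : ℝ) ^ (-((s + 1 : ℕ) : ℤ))) + 2 * b * (s + 1 : ℕ) := by
        rw [hz2, hcast]
        intro j hj
        obtain ⟨hjA, hjmax⟩ := (hsurv j).1 hj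
        have h1 := hjmax i hi
        have h2 := hlow s hsI i (hA hi)
        have h3 := hup s hsI j (hA hjA)
        have h4 := hprec j hjA
        linarith
      obtain ⟨g1, g2, g3, g4, g5⟩ := ih (s + 1) (survivingArms start N n B δ v h x s A) (by omega)
        (by omega) (fun j hj => hA ((hsurv j).1 hj).1) hex' hall'
      exact ⟨by omega, by omega, ((hsurv _).1 g3).1, fun h => g4 (by omega), g5⟩

/-- The prices of the arms form a grid of mesh `(B + 2 ‖v‖) / N` that covers `[0, B]`. -/
lemma exists_armPrice_near {B : ℝ} {v : X → ℝ} {N : ℕ} {x : X} (hN : 1 ≤ N)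
    (hv : |v x| ≤ supNorm v) (hB : 0 < B) {p : ℝ} (hp : (B + 2 * supNorm v) / N < p) (hpB : p ≤ B) :
    ∃ j ∈ Finset.Icc 1 N, p - (B + 2 * supNorm v) / N ≤ armPrice B v N x j ∧
      armPrice B v N x j < p := by
  set M := supNorm v
  set w := (B + 2 * M) / N with hw
  have hN0 : (0 : ℝ) < N := by exact_mod_cast hN
  have hM : 0 ≤ M := (abs_nonneg _).trans hv
  have hw0 : 0 < w := by positivity
  have hwN : N * w = B + 2 * M := by rw [hw]; field_simp
  obtain ⟨hv1, hv2⟩ := abs_le.1 hv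
  set y := (p + M - v x) / w with hy
  have hyw : y * w = p + M - v x := by rw [hy]; field_simp
  -- In mesh units from the left end of the grid, `p` sits at `y`. The index `⌈y - 1/2⌉` has its
  -- midpoint in `[y - 1, y)`, and `1 < y ≤ N` makes it an admissible index.
  have hy1 : 1 < y := by rw [hy, lt_div_iff₀ hw0]; linarith
  have hyN : y ≤ N := by rw [hy, div_le_iff₀ hw0]; linarith
  have hc1 := Nat.le_ceil (y - 1 / 2)
  have hc2 := Nat.ceil_lt_add_one (a := y - 1 / 2) (by linarith)
  refine ⟨⌈y - 1 / 2⌉₊, Finset.mem_Icc.2 ⟨?_, ?_⟩, ?_, ?_⟩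
  · exact Nat.one_le_ceil_iff.2 (by linarith)
  · exact Nat.ceil_le.2 (by linarith)
  · unfold armPrice midpoint
    change p - w ≤ -M + (_ - 1 / 2) * w + v x
    have : (y - 1) * w ≤ ((⌈y - 1 / 2⌉₊ : ℝ) - 1 / 2) * w :=
      mul_le_mul_of_nonneg_right (by linarith) hw0.le
    linarith
  · unfold armPrice midpoint
    change -M + (_ - 1 / 2) * w + v x < p
    have : ((⌈y - 1 / 2⌉₊ : ℝ) - 1 / 2) * w < y * w :=
      mul_lt_mul_of_pos_right (by linarith) hw0
    linarith

/-- The price of arm `j` minus the valuation is `m_j + (v - vstar)(x)`. Hence the conditional sale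
probabilities of all recorded rounds lie within `L * err` of `1 - F(m_j)`, and the martingale part
is controlled by `hdev`. When the radius is capped at `1`, the bound is trivial because both
quantities lie in `[0, 1]`. -/
lemma abs_sampleMean_sub_le {F : ℝ → ℝ} {vstar v : X → ℝ} {L err B δ : ℝ} {start N n s j : ℕ}
    {h : Fin t → Rec X} (hF : ∀ c, F c ∈ Set.Icc (0 : ℝ) 1) (hL0 : 0 ≤ L)
    (hL : ∀ a b, |F a - F b| ≤ L * |a - b|) (herr : ∀ y, |v y - vstar y| ≤ err) (herr0 : 0 ≤ err)
    (hprice : ∀ τ ∈ armRounds start h s j, (h τ).price = armPrice B v N (h τ).ctx j)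
    (hdev : 0 < (armRounds start h s j).card →
      |∑ τ ∈ armRounds start h s j, excess F vstar (h τ)| ≤ (armRounds start h s j).card *
        Real.sqrt (2 * Real.log (2 * numLayers n * N * n / δ) / (armRounds start h s j).card)) :
    |sampleMean start h s j - (1 - F (midpoint B (supNorm v) N j))| ≤
      radius start N n δ h s j + L * err := by
  have hLe : 0 ≤ L * err := mul_nonneg hL0 herr0
  obtain ⟨hd0, hd1⟩ := hF (midpoint B (supNorm v) N j)
  set d := 1 - F (midpoint B (supNorm v) N j) with hd
  unfold radius
  split_ifs with hc
  · have : sampleMean start h s j = 0 := by simp [sampleMean, hc]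
    rw [this]
    exact abs_le.2 ⟨by linarith, by linarith⟩
  · have hpos : 0 < (armRounds start h s j).card := Nat.pos_of_ne_zero hc
    have hdev := hdev hpos
    set A := armRounds start h s j
    have hA : (0 : ℝ) < A.card := by exact_mod_cast hpos
    set r := Real.sqrt (2 * Real.log (2 * numLayers n * N * n / δ) / A.card)
    rw [← min_add_add_right]
    refine le_min ?_ ?_
    · have hsum : A.card * (sampleMean start h s j - d) =
          ∑ τ ∈ A, excess F vstar (h τ) +
            ∑ τ ∈ A, ((1 - F ((h τ).price - vstar (h τ).ctx)) - d) := by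
        rw [← Finset.sum_add_distrib, mul_sub, sampleMean, mul_div_cancel₀ _ hA.ne', ← nsmul_eq_mul,
          ← Finset.sum_const, ← Finset.sum_sub_distrib]
        exact Finset.sum_congr rfl fun τ _ => by unfold excess; ring
      have hbias : |∑ τ ∈ A, ((1 - F ((h τ).price - vstar (h τ).ctx)) - d)| ≤
          A.card * (L * err) := by
        refine (Finset.abs_sum_le_sum_abs _ _).trans ?_
        rw [← nsmul_eq_mul]
        refine Finset.sum_le_card_nsmul _ _ _ fun τ hτ => ?_
        rw [hprice τ hτ, hd]
        have h1 := hL (midpoint B (supNorm v) N j)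
          (armPrice B v N (h τ).ctx j - vstar (h τ).ctx)
        have h2 : midpoint B (supNorm v) N j - (armPrice B v N (h τ).ctx j - vstar (h τ).ctx) =
            -(v (h τ).ctx - vstar (h τ).ctx) := by unfold armPrice; ring
        rw [h2, abs_neg] at h1
        have h3 : ∀ p q : ℝ, 1 - p - (1 - q) = q - p := fun p q => by ring
        rw [h3]
        exact h1.trans (mul_le_mul_of_nonneg_left (herr _) hL0)
      have htot : A.card * |sampleMean start h s j - d| ≤ A.card * (r + L * err) := by
        rw [← abs_of_pos hA, ← abs_mul, abs_of_pos hA, hsum, mul_add]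
        exact (abs_add_le _ _).trans (add_le_add hdev hbias)
      exact le_of_mul_le_mul_left htot hA
    · have h0 : 0 ≤ sampleMean start h s j := by
        unfold sampleMean
        exact div_nonneg (Finset.sum_nonneg fun τ _ => by split_ifs <;> norm_num) hA.le
      have h1 : sampleMean start h s j ≤ 1 := by
        unfold sampleMean
        rw [div_le_one hA]
        calc _ ≤ ∑ τ ∈ A, (1 : ℝ) := Finset.sum_le_sum fun τ _ => by split_ifs <;> norm_num
          _ = A.card := by simp
      exact abs_le.2 ⟨by linarith, by linarith⟩

lemma radius_nonneg {start N n s j : ℕ} {δ : ℝ} {h : Fin t → Rec X} :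
    0 ≤ radius start N n δ h s j := by
  unfold radius
  split_ifs
  · norm_num
  · exact le_min (Real.sqrt_nonneg _) zero_le_one

/-- The bias `L * err` enters twice: once through the sample mean, and once when `F(m_j)` is
replaced by its value at the actual price and context. -/
lemma ucb_bounds {F : ℝ → ℝ} {vstar v : X → ℝ} {L err B δ : ℝ} {start N n s j : ℕ}
    {h : Fin t → Rec X} {x : X} (hL0 : 0 ≤ L)
    (hL : ∀ a b, |F a - F b| ≤ L * |a - b|) (herr : ∀ y, |v y - vstar y| ≤ err)
    (hmean : |sampleMean start h s j - (1 - F (midpoint B (supNorm v) N j))| ≤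
      radius start N n δ h s j + L * err)
    (hP0 : 0 < armPrice B v N x j) (hPB : armPrice B v N x j < B) :
    revenue F (vstar x) (armPrice B v N x j) - 2 * (B * (L * err)) ≤
        ucb start N n B δ v h x s j ∧
      ucb start N n B δ v h x s j ≤ revenue F (vstar x) (armPrice B v N x j) +
        2 * (armPrice B v N x j * radius start N n δ h s j) + 2 * (B * (L * err)) := by
  have h1 := hL (armPrice B v N x j - vstar x) (midpoint B (supNorm v) N j)
  have h2 : armPrice B v N x j - vstar x - midpoint B (supNorm v) N j = v x - vstar x := by
    unfold armPrice; ring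
  rw [h2] at h1
  have h3 := h1.trans (mul_le_mul_of_nonneg_left (herr x) hL0)
  have hLe : 0 ≤ L * err := mul_nonneg hL0 ((abs_nonneg _).trans (herr x))
  unfold ucb revenue
  set P := armPrice B v N x j
  set d := F (midpoint B (supNorm v) N j)
  set f := F (P - vstar x)
  set w := sampleMean start h s j
  set r := radius start N n δ h s j
  obtain ⟨a1, a2⟩ := abs_le.1 h3
  obtain ⟨b1, b2⟩ := abs_le.1 hmean
  have hPL : P * (L * err) ≤ B * (L * err) := mul_le_mul_of_nonneg_right hPB.le hLe
  constructor
  · have : P * (1 - f) - 2 * (P * (L * err)) ≤ P * (w + r) := by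
      have : P * (1 - f - 2 * (L * err)) ≤ P * (w + r) :=
        mul_le_mul_of_nonneg_left (by linarith) hP0.le
      linarith
    linarith
  · have : P * (w + r) ≤ P * (1 - f + 2 * r + 2 * (L * err)) :=
      mul_le_mul_of_nonneg_left (by linarith) hP0.le
    linarith

end Traversal

/-! ### Counting the rounds that stop at each layer. -/

section Counting

variable {X : Type*}

lemma card_armRounds (z : ℕ → Rec X) (a t s j : ℕ) :
    (armRounds a (fun i : Fin t => z i) s j).card =
      ((Finset.Ico a t).filter fun τ => (z τ).layer = s ∧ (z τ).arm = j).card := by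
  rw [← Finset.card_map Fin.valEmbedding]
  congr 1
  ext τ
  simp only [armRounds, Finset.mem_map, Finset.mem_filter, Finset.mem_univ, true_and,
    Fin.valEmbedding_apply, Finset.mem_Ico]
  constructor
  · rintro ⟨i, ⟨h1, h2⟩, rfl⟩
    exact ⟨⟨h1, i.2⟩, h2⟩
  · rintro ⟨⟨h1, h2⟩, h3⟩
    exact ⟨⟨τ, h2⟩, ⟨h1, h3⟩, rfl⟩

/-- Only the last round of the class matters. Its radius exceeds `q = 2 ^ (-s)` and was computed
from one fewer data, so `q² (card - 1) < 2 Λ`. If `q > θ`, dividing by `θ` bounds `q * card`, the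
missing round giving the `1` in `1 + 2 Λ`. If `q ≤ θ`, the first term already suffices. -/
lemma weight_mul_card_le {z : ℕ → Rec X} {a n s j : ℕ} {θ Λ : ℝ} (hθ : 0 < θ) (hθ1 : θ ≤ 1)
    (hΛ : 0 ≤ Λ)
    (hr : ∀ t ∈ Finset.Ico a (a + n), (z t).layer = s → (z t).arm = j →
      0 < ((Finset.Ico a t).filter fun τ => (z τ).layer = s ∧ (z τ).arm = j).card →
      (2 : ℝ) ^ (-(s : ℤ)) < Real.sqrt (2 * Λ /
        ((Finset.Ico a t).filter fun τ => (z τ).layer = s ∧ (z τ).arm = j).card)) :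
    (2 : ℝ) ^ (-(s : ℤ)) *
        ((Finset.Ico a (a + n)).filter fun τ => (z τ).layer = s ∧ (z τ).arm = j).card ≤
      θ * ((Finset.Ico a (a + n)).filter fun τ => (z τ).layer = s ∧ (z τ).arm = j).card +
        (1 + 2 * Λ) / θ := by
  set Ψ := (Finset.Ico a (a + n)).filter fun τ => (z τ).layer = s ∧ (z τ).arm = j with hΨ
  set q := (2 : ℝ) ^ (-(s : ℤ)) with hq
  have hq0 : 0 < q := by positivity
  have hq1 : q ≤ 1 := by
    rw [hq, zpow_neg, zpow_natCast]
    exact inv_le_one_of_one_le₀ (one_le_pow₀ (by norm_num))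
  have hΛθ : 0 ≤ (1 + 2 * Λ) / θ := by positivity
  rcases le_or_gt q θ with hle | hgt
  · have := mul_le_mul_of_nonneg_right hle (Nat.cast_nonneg (α := ℝ) Ψ.card)
    linarith
  · have hm0 : (0 : ℝ) ≤ Ψ.card := Nat.cast_nonneg _
    suffices hm : q * Ψ.card ≤ (1 + 2 * Λ) / θ by
      have := mul_nonneg hθ.le hm0
      linarith
    rcases Ψ.eq_empty_or_nonempty with he | hne
    · simpa [he] using hΛθ
    · set t := Ψ.max' hne with ht
      have htΨ : t ∈ Ψ := Ψ.max'_mem hne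
      have herase : (Finset.Ico a t).filter (fun τ => (z τ).layer = s ∧ (z τ).arm = j) =
          Ψ.erase t := by
        ext τ
        simp only [hΨ, Finset.mem_filter, Finset.mem_Ico, Finset.mem_erase]
        have ht2 : t < a + n := (Finset.mem_Ico.1 (Finset.mem_filter.1 htΨ).1).2
        constructor
        · rintro ⟨⟨h1, h2⟩, h3⟩
          exact ⟨by omega, ⟨h1, by omega⟩, h3⟩
        · rintro ⟨h1, ⟨h2, h3⟩, h4⟩
          have hle : τ ≤ t := Ψ.le_max' τ (by
            simp only [hΨ, Finset.mem_filter, Finset.mem_Ico]; exact ⟨⟨h2, h3⟩, h4⟩)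
          exact ⟨⟨h2, by omega⟩, h4⟩
      have hcard := Finset.card_erase_add_one htΨ
      have htf := Finset.mem_filter.1 htΨ
      have hrt := hr t htf.1 htf.2.1 htf.2.2
      rw [herase] at hrt
      rw [← hcard]
      push_cast
      rcases Nat.eq_zero_or_pos (Ψ.erase t).card with h0 | hpos
      · rw [h0, le_div_iff₀ hθ]
        push_cast
        nlinarith [mul_le_one₀ hq1 hθ.le hθ1]
      · have hm1 : (0 : ℝ) < (Ψ.erase t).card := by exact_mod_cast hpos
        have h1 := Real.lt_sqrt (hq0.le) |>.1 (hrt hpos)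
        rw [lt_div_iff₀ hm1] at h1
        have h2 : q * (Ψ.erase t).card * θ ≤ 2 * Λ := by nlinarith [mul_pos hq0 hm1]
        rw [le_div_iff₀ hθ]
        nlinarith

/-- The total weight `2 ^ (-s)` of the rounds of a phase, `s` being the layer of the round. -/
lemma sum_layer_weights_le {z : ℕ → Rec X} {a n S N : ℕ} {θ Λ : ℝ} (hθ : 0 < θ) (hθ1 : θ ≤ 1)
    (hΛ : 0 ≤ Λ)
    (hact : ∀ t ∈ Finset.Ico a (a + n), 1 ≤ (z t).layer →
      (z t).layer ≤ S ∧ (z t).arm ∈ Finset.Icc 1 N)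
    (hr : ∀ t ∈ Finset.Ico a (a + n), 1 ≤ (z t).layer → (z t).layer < S →
      0 < ((Finset.Ico a t).filter fun τ =>
        (z τ).layer = (z t).layer ∧ (z τ).arm = (z t).arm).card →
      (2 : ℝ) ^ (-((z t).layer : ℤ)) < Real.sqrt (2 * Λ / ((Finset.Ico a t).filter fun τ =>
        (z τ).layer = (z t).layer ∧ (z τ).arm = (z t).arm).card)) :
    ∑ t ∈ (Finset.Ico a (a + n)).filter (fun t => 1 ≤ (z t).layer),
      (2 : ℝ) ^ (-((z t).layer : ℤ)) ≤
      ((2 : ℝ) ^ (-(S : ℤ)) + θ) * n + S * N * ((1 + 2 * Λ) / θ) := by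
  set I := Finset.Icc 1 S ×ˢ Finset.Icc 1 N with hI
  set Φ := (Finset.Ico a (a + n)).filter (fun t => 1 ≤ (z t).layer) with hΦ
  have hmaps : ∀ t ∈ Φ, ((z t).layer, (z t).arm) ∈ I := fun t ht => by
    have ht := Finset.mem_filter.1 ht
    have := hact t ht.1 ht.2
    exact Finset.mem_product.2 ⟨Finset.mem_Icc.2 ⟨ht.2, this.1⟩, this.2⟩
  have hΛθ : 0 ≤ (1 + 2 * Λ) / θ := by positivity
  have hfib : ∀ p ∈ I, Φ.filter (fun t => ((z t).layer, (z t).arm) = p) =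
      (Finset.Ico a (a + n)).filter fun τ => (z τ).layer = p.1 ∧ (z τ).arm = p.2 := by
    rintro ⟨s, j⟩ hp
    have hs := (Finset.mem_Icc.1 (Finset.mem_product.1 hp).1).1
    ext τ
    simp only [hΦ, Finset.mem_filter, Prod.mk.injEq]
    constructor
    · rintro ⟨⟨h1, h2⟩, h3⟩; exact ⟨h1, h3⟩
    · rintro ⟨h1, h3⟩; exact ⟨⟨h1, by rw [h3.1]; exact hs⟩, h3⟩
  have hcardsum : ∑ p ∈ I, ((Φ.filter fun t => ((z t).layer, (z t).arm) = p).card : ℝ) ≤ n := by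
    rw [← Nat.cast_sum, ← Finset.card_eq_sum_card_fiberwise hmaps]
    have : Φ.card ≤ n := (Finset.card_filter_le _ _).trans (by simp)
    exact_mod_cast this
  rw [← Finset.sum_fiberwise_of_maps_to hmaps]
  have hstep : ∀ p ∈ I, ∑ t ∈ Φ.filter (fun t => ((z t).layer, (z t).arm) = p),
      (2 : ℝ) ^ (-((z t).layer : ℤ)) ≤ ((2 : ℝ) ^ (-(S : ℤ)) + θ) *
        (Φ.filter fun t => ((z t).layer, (z t).arm) = p).card + (1 + 2 * Λ) / θ := by
    rintro ⟨s, j⟩ hp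
    have hs := Finset.mem_Icc.1 (Finset.mem_product.1 hp).1
    have h1 : ∑ t ∈ Φ.filter (fun t => ((z t).layer, (z t).arm) = (s, j)),
        (2 : ℝ) ^ (-((z t).layer : ℤ)) = (2 : ℝ) ^ (-(s : ℤ)) *
          (Φ.filter fun t => ((z t).layer, (z t).arm) = (s, j)).card := by
      rw [mul_comm, ← nsmul_eq_mul, ← Finset.sum_const]
      refine Finset.sum_congr rfl fun t ht => ?_
      have := (Finset.mem_filter.1 ht).2
      simp only [Prod.mk.injEq] at this
      rw [this.1]
    rw [h1, hfib _ hp]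
    have hS0 : (0 : ℝ) < (2 : ℝ) ^ (-(S : ℤ)) := by positivity
    -- No precision check occurs at the last layer, so its rounds are charged their full weight `2 ^
    -- (-S)`.
    rcases hs.2.lt_or_eq with hlt | rfl
    · have := weight_mul_card_le (z := z) (a := a) (n := n) (s := s) (j := j) hθ hθ1 hΛ ?_
      · have h2 := mul_nonneg hS0.le (Nat.cast_nonneg (α := ℝ)
          ((Finset.Ico a (a + n)).filter fun τ => (z τ).layer = s ∧ (z τ).arm = j).card)
        dsimp only
        linarith
      · intro t ht hl ha hpos
        subst hl ha
        exact hr t ht hs.1 hlt hpos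
    · have h2 := mul_nonneg hθ.le (Nat.cast_nonneg (α := ℝ)
          ((Finset.Ico a (a + n)).filter fun τ => (z τ).layer = s ∧ (z τ).arm = j).card)
      dsimp only
      linarith
  refine (Finset.sum_le_sum hstep).trans ?_
  rw [Finset.sum_add_distrib, ← Finset.mul_sum, Finset.sum_const, nsmul_eq_mul]
  have hIc : (I.card : ℝ) = S * N := by simp [hI]
  rw [hIc]
  have := mul_le_mul_of_nonneg_left hcardsum (by positivity : 0 ≤ (2 : ℝ) ^ (-(S : ℤ)) + θ)
  linarith

end Counting

/-! ### Deterministic properties of the revenue. -/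

/-- The properties of the noise distribution function and of the valuations that are used in the
regret analysis. -/
structure IsRegularMarket {X : Type*} (F : ℝ → ℝ) (vstar : X → ℝ) (B L : ℝ) : Prop where
  mem_Icc : ∀ c, F c ∈ Set.Icc (0 : ℝ) 1
  mono : Monotone F
  lipschitz : ∀ a b, |F a - F b| ≤ L * |a - b|
  eq_one : ∀ x p, B ≤ p → F (p - vstar x) = 1
  abs_le : ∀ x, |vstar x| ≤ B

section Revenue

variable {X : Type*} {F : ℝ → ℝ} {vstar pstar : X → ℝ} {B L : ℝ}

lemma IsRegularMarket.revenue_nonneg (h : IsRegularMarket F vstar B L) (v : ℝ) {p : ℝ}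
    (hp : 0 ≤ p) : 0 ≤ revenue F v p :=
  mul_nonneg hp (sub_nonneg.2 (h.mem_Icc _).2)

lemma IsRegularMarket.revenue_le_price (h : IsRegularMarket F vstar B L) (v : ℝ) {p : ℝ}
    (hp : 0 ≤ p) : revenue F v p ≤ p :=
  mul_le_of_le_one_right hp (by linarith [(h.mem_Icc (p - v)).1])

lemma IsRegularMarket.revenue_eq_zero (h : IsRegularMarket F vstar B L) (x : X) {p : ℝ}
    (hp : B ≤ p) : revenue F (vstar x) p = 0 := by
  simp [revenue, h.eq_one x p hp]

lemma IsRegularMarket.revenue_le (h : IsRegularMarket F vstar B L) (hB : 0 < B) (x : X) {p : ℝ}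
    (hp : 0 ≤ p) : revenue F (vstar x) p ≤ B := by
  rcases le_total p B with hle | hle
  · exact (h.revenue_le_price _ hp).trans hle
  · rw [h.revenue_eq_zero x hle]; exact hB.le

/-- A negative price earns nonpositive revenue, so optimality extends to all real prices.
Nonnegativity permits completing the last episode beyond the horizon. -/
lemma IsRegularMarket.regret_nonneg (h : IsRegularMarket F vstar B L)
    (hopt : IsOptimalPricing F vstar pstar) (x : X) (p : ℝ) :
    0 ≤ revenue F (vstar x) (pstar x) - revenue F (vstar x) p := by
  rcases le_total 0 p with hp | hp
  · exact sub_nonneg.2 ((hopt x).2 p hp)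
  · have h1 := h.revenue_nonneg (vstar x) (hopt x).1
    have h2 : revenue F (vstar x) p ≤ 0 :=
      mul_nonpos_of_nonpos_of_nonneg hp (sub_nonneg.2 (h.mem_Icc _).2)
    linarith

lemma IsRegularMarket.regret_le (h : IsRegularMarket F vstar B L) (hB : 0 < B)
    (hopt : IsOptimalPricing F vstar pstar) (x : X) {p : ℝ} (hp : 0 ≤ p) :
    revenue F (vstar x) (pstar x) - revenue F (vstar x) p ≤ B := by
  linarith [h.revenue_nonneg (vstar x) hp, h.revenue_le hB x (hopt x).1]

end Revenue

/-! ### The regret of one UCB round. -/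

section Round

variable {X : Type*} {F : ℝ → ℝ} {vstar pstar : X → ℝ} {B L : ℝ} {t : ℕ}

/-- Lowering a price never lowers the sale probability, so the arm just below the optimal price
loses at most the mesh. If the optimal price is itself below the mesh, so is its revenue; if it
exceeds `B`, its revenue is zero. -/
lemma IsRegularMarket.exists_arm_near_optimal (hF : IsRegularMarket F vstar B L) (hB : 0 < B)
    (hopt : IsOptimalPricing F vstar pstar) {v : X → ℝ} {N : ℕ} (hN : 1 ≤ N) {x : X}
    (hv : |v x| ≤ supNorm v) :
    revenue F (vstar x) (pstar x) ≤ (B + 2 * supNorm v) / N ∨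
      ∃ j ∈ initialArms B v N x, revenue F (vstar x) (pstar x) ≤
        revenue F (vstar x) (armPrice B v N x j) + (B + 2 * supNorm v) / N := by
  have hM : 0 ≤ supNorm v := (abs_nonneg _).trans hv
  have hw0 : 0 ≤ (B + 2 * supNorm v) / N := by positivity
  rcases le_or_gt (pstar x) ((B + 2 * supNorm v) / N) with h1 | h1
  · exact Or.inl ((hF.revenue_le_price _ (hopt x).1).trans h1)
  rcases le_or_gt (pstar x) B with h2 | h2
  · obtain ⟨j, hj, hlow, hup⟩ := exists_armPrice_near hN hv hB h1 h2
    refine Or.inr ⟨j, ?_, ?_⟩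
    · simp only [initialArms, Finset.mem_filter]
      exact ⟨hj, by linarith, by linarith⟩
    · have hmono := hF.mono (sub_le_sub_right hup.le (vstar x))
      obtain ⟨h3, h4⟩ := hF.mem_Icc (pstar x - vstar x)
      unfold revenue
      have h5 : (pstar x - (B + 2 * supNorm v) / N) * (1 - F (pstar x - vstar x)) ≤
          armPrice B v N x j * (1 - F (armPrice B v N x j - vstar x)) :=
        mul_le_mul hlow (by linarith) (by linarith) (by linarith)
      nlinarith [mul_nonneg hw0 h3]
  · rw [hF.revenue_eq_zero x h2.le]
    exact Or.inl hw0

/-- One round of the UCB phase when the sample means are accurate. -/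
lemma IsRegularMarket.ucbRound_spec (hF : IsRegularMarket F vstar B L) (hB : 0 < B) (hL0 : 0 ≤ L)
    (hopt : IsOptimalPricing F vstar pstar) {v : X → ℝ} {start N n : ℕ} {δ err : ℝ} (hN : 1 ≤ N)
    (hS : 1 ≤ numLayers n) {x : X} (hv : |v x| ≤ supNorm v) (herr : ∀ y, |v y - vstar y| ≤ err)
    {h : Fin t → Rec X} {pick : Finset ℕ → ℕ} (hpick : ∀ A : Finset ℕ, A.Nonempty → pick A ∈ A)
    {u : ℝ} (hu : 0 ≤ u)
    (hmean : ∀ s ∈ Finset.Icc 1 (numLayers n), ∀ j ∈ Finset.Icc 1 N,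
      |sampleMean start h s j - (1 - F (midpoint B (supNorm v) N j))| ≤
        radius start N n δ h s j + L * err) :
    let a := ucbRound start N n B δ v h x pick u
    let w := (B + 2 * supNorm v) / N
    (a.2.1 = 0 ∧ revenue F (vstar x) (pstar x) - revenue F (vstar x) a.1 ≤ w) ∨
    (1 ≤ a.2.1 ∧ a.2.1 ≤ numLayers n ∧ a.2.2 ∈ Finset.Icc 1 N ∧
      (a.2.1 < numLayers n → (2 : ℝ) ^ (-(a.2.1 : ℤ)) < radius start N n δ h a.2.1 a.2.2) ∧
      revenue F (vstar x) (pstar x) - revenue F (vstar x) a.1 ≤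
        w + 4 * (B * (L * err)) * numLayers n + 8 * B * (2 : ℝ) ^ (-(a.2.1 : ℤ))) := by
  have hnear := hF.exists_arm_near_optimal hB hopt (v := v) (N := N) hN hv
  have herr0 : 0 ≤ err := (abs_nonneg _).trans (herr x)
  have hM : 0 ≤ supNorm v := (abs_nonneg _).trans hv
  have hw0 : 0 ≤ (B + 2 * supNorm v) / N := by positivity
  set A₀ := initialArms B v N x with hA₀
  intro a w
  by_cases hne : A₀.Nonempty
  · right
    have hA : ∀ j ∈ A₀, j ∈ Finset.Icc 1 N ∧ 0 < armPrice B v N x j ∧ armPrice B v N x j < B :=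
      fun j hj => by simpa only [hA₀, initialArms, Finset.mem_filter] using hj
    have hbounds := fun s (hs : s ∈ Finset.Icc 1 (numLayers n)) j (hj : j ∈ A₀) =>
      ucb_bounds hL0 hF.lipschitz herr (hmean s hs j (hA j hj).1) (hA j hj).2.1 (hA j hj).2.2
    have ha : a = (armPrice B v N x (traverse start N n B δ v h x pick (numLayers n - 1) 1 A₀).2,
        (traverse start N n B δ v h x pick (numLayers n - 1) 1 A₀).1,
        (traverse start N n B δ v h x pick (numLayers n - 1) 1 A₀).2) := by
      simp only [a, ucbRound, ← hA₀, if_pos hne]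
    obtain ⟨i, hi, hmax⟩ := A₀.exists_max_image
      (fun j => revenue F (vstar x) (armPrice B v N x j)) hne
    have hR0 : ∀ j ∈ A₀, 0 ≤ revenue F (vstar x) (armPrice B v N x j) := fun j hj =>
      hF.revenue_nonneg _ (hA j hj).2.1.le
    have hb0 : 0 ≤ 2 * (B * (L * err)) := by positivity
    obtain ⟨g1, g2, g3, g4, g5⟩ := traverse_spec hpick hb0 hB
      (fun s hs j hj => (hbounds s hs j hj).1) (fun s hs j hj => (hbounds s hs j hj).2)
      (numLayers n - 1) 1 A₀ le_rfl (by omega) subset_rfl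
      -- At layer `1` the invariants are free: the best arm has no deficit, and every gap is at most
      -- `B`, below `8 B / 2`.
      (Rs := revenue F (vstar x) (armPrice B v N x i)) ⟨i, hi, by simp⟩ (fun j hj => by
        have h1 := hR0 j hj
        have h2 := hF.revenue_le_price (vstar x) (hA i hi).2.1.le
        have h3 := (hA i hi).2.2
        norm_num
        linarith)
    rw [ha]
    dsimp only
    set r := traverse start N n B δ v h x pick (numLayers n - 1) 1 A₀ with hr
    have hr2 : r.1 ≤ numLayers n := by omega
    refine ⟨g1, hr2, (hA _ g3).1, fun hlt => ?_, ?_⟩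
    · have h1 := g4 (by omega)
      have h2 : armPrice B v N x r.2 * radius start N n δ h r.1 r.2 ≤
          B * radius start N n δ h r.1 r.2 :=
        mul_le_mul_of_nonneg_right (hA _ g3).2.2.le radius_nonneg
      exact lt_of_mul_lt_mul_left (h1.trans_le h2) hB.le
    · have hopt' : revenue F (vstar x) (pstar x) ≤
          revenue F (vstar x) (armPrice B v N x i) + w := by
        rcases hnear with h1 | ⟨j, hj, h1⟩
        · linarith [hR0 i hi]
        · have := hmax j hj
          linarith
      have h2 : 2 * (2 * (B * (L * err))) * (r.1 : ℝ) ≤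
          2 * (2 * (B * (L * err))) * (numLayers n : ℝ) :=
        mul_le_mul_of_nonneg_left (by exact_mod_cast hr2) (by positivity)
      linarith
  · left
    have ha : a = (u, 0, 0) := by simp only [a, ucbRound, ← hA₀, if_neg hne]
    rw [ha]
    refine ⟨rfl, ?_⟩
    have h1 := hF.revenue_nonneg (vstar x) hu
    rcases hnear with h2 | ⟨j, hj, -⟩
    · linarith
    · exact absurd ⟨j, hj⟩ hne

end Round

/-! ### The regret of a UCB phase. -/

section Phase

variable {X : Type*} {F : ℝ → ℝ} {vstar pstar : X → ℝ} {B L ρ δ : ℝ} {Te : ℕ → ℕ}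
  {orc : Oracle X} {sel : Selector X} {x : ℕ → X} {e u : ℕ → ℝ} {k : ℕ}

lemma history_eq (pol : Policy X) (t : ℕ) : history pol vstar x e u t =
    fun i : Fin t => roundRec pol vstar x e u i := funext fun i => history_apply _ _ _ _ _ _ i

lemma pricingAlgorithm_apply_of_ucb (hk : 1 ≤ k) (hkρ : firstEpisode ρ ≤ k) {t : ℕ}
    (h1 : episodeLength k + Te k ≤ t) (h2 : t < 2 * episodeLength k) (h : Fin t → Rec X) (x : X)
    (u : ℝ) : pricingAlgorithm B ρ δ Te orc sel t h x u =
    ucbRound (episodeLength k + Te k) (numArms (episodeLength k - Te k) δ)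
      (episodeLength k - Te k) B δ (orc (Te k) (samples h (episodeLength k) (Te k) h1)) h x
      (sel t h x) u := by
  obtain rfl : episodeOf t = k := episodeOf_eq hk (by omega) h2
  have hmono : episodeLength (firstEpisode ρ) ≤ episodeLength (episodeOf t) :=
    Nat.pow_le_pow_right (by norm_num) (by omega)
  unfold pricingAlgorithm
  simp only
  rw [if_neg (by omega), dif_pos h1]

lemma pricingAlgorithm_eq_ucbRound (hk : 1 ≤ k) (hkρ : firstEpisode ρ ≤ k)
    (hTe : Te k ≤ episodeLength k) {t : ℕ}
    (h1 : episodeLength k + Te k ≤ t) (h2 : t < 2 * episodeLength k) :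
    pricingAlgorithm B ρ δ Te orc sel t
      (history (pricingAlgorithm B ρ δ Te orc sel) vstar x e u t) (x t) (u t) =
    ucbRound (episodeLength k + Te k) (numArms (episodeLength k - Te k) δ)
      (episodeLength k - Te k) B δ
      (orc (Te k) fun i : Fin (Te k) => (x (episodeLength k + i), decide (u (episodeLength k + i) ≤
        vstar (x (episodeLength k + i)) + e (episodeLength k + i))))
      (history (pricingAlgorithm B ρ δ Te orc sel) vstar x e u t) (x t)
      (sel t (history (pricingAlgorithm B ρ δ Te orc sel) vstar x e u t) (x t)) (u t) := by
  rw [pricingAlgorithm_apply_of_ucb hk hkρ h1 h2, samples_history vstar x e u hk hTe h1]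

/-- The regret of a UCB phase on the event that the predictor and the confidence radii are valid. -/
lemma IsRegularMarket.phase_regret_le (hF : IsRegularMarket F vstar B L) (hB : 0 < B)
    (hL0 : 0 ≤ L) (hopt : IsOptimalPricing F vstar pstar)
    (hsel : ∀ t h x A, A.Nonempty → sel t h x A ∈ A) (hu : ∀ t, 0 ≤ u t)
    (hk : 1 ≤ k) (hkρ : firstEpisode ρ ≤ k) (hTe : Te k ≤ episodeLength k)
    {err : ℝ} {v : X → ℝ} (hv : v = orc (Te k) fun i : Fin (Te k) => (x (episodeLength k + i),
      decide (u (episodeLength k + i) ≤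
        vstar (x (episodeLength k + i)) + e (episodeLength k + i))))
    (herr : ∀ y, |v y - vstar y| ≤ err) {a n N S : ℕ} (ha : a = episodeLength k + Te k)
    (hn : n = episodeLength k - Te k) (hN : N = numArms n δ) (hS : S = numLayers n)
    (hN1 : 1 ≤ N) (hS1 : 1 ≤ S) {Λ θ : ℝ} (hΛ : Λ = Real.log (2 * S * N * n / δ)) (hΛ0 : 0 ≤ Λ)
    (hθ : 0 < θ) (hθ1 : θ ≤ 1)
    (hdev : ∀ t ∈ Finset.Ico a (a + n), ∀ s ∈ Finset.Icc 1 S, ∀ j ∈ Finset.Icc 1 N,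
      ∀ h, h = history (pricingAlgorithm B ρ δ Te orc sel) vstar x e u t →
        0 < (armRounds a h s j).card → |∑ τ ∈ armRounds a h s j, excess F vstar (h τ)| ≤
          (armRounds a h s j).card * Real.sqrt (2 * Λ / (armRounds a h s j).card)) :
    ∑ t ∈ Finset.Ico a (a + n), (revenue F (vstar (x t)) (pstar (x t)) - revenue F (vstar (x t))
        (postedPrice (pricingAlgorithm B ρ δ Te orc sel) vstar x e u t)) ≤
      n * ((3 * B + 2 * err) / N + 4 * (B * (L * err)) * S) +
        8 * B * (((2 : ℝ) ^ (-(S : ℤ)) + θ) * n + S * N * ((1 + 2 * Λ) / θ)) := by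
  set pol := pricingAlgorithm B ρ δ Te orc sel with hpol
  set z := roundRec pol vstar x e u with hz
  have herr0 : 0 ≤ err := (abs_nonneg _).trans (herr (x 0))
  have hvb : ∀ y, |v y| ≤ B + err := fun y => by
    have := abs_sub_abs_le_abs_sub (v y) (vstar y)
    linarith [herr y, hF.abs_le y]
  have hvM : ∀ y, |v y| ≤ supNorm v := fun y =>
    le_ciSup (f := fun y => |v y|) ⟨B + err, by rintro _ ⟨y, rfl⟩; exact hvb y⟩ y
  have hM : supNorm v ≤ B + err := by
    have : Nonempty X := ⟨x 0⟩
    exact ciSup_le hvb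
  have hN0 : (0 : ℝ) < N := by exact_mod_cast hN1
  have hround : ∀ t ∈ Finset.Ico a (a + n), z t = (x t,
      (ucbRound a N n B δ v (history pol vstar x e u t) (x t)
        (sel t (history pol vstar x e u t) (x t)) (u t)).1, (z t).sale,
      (ucbRound a N n B δ v (history pol vstar x e u t) (x t)
        (sel t (history pol vstar x e u t) (x t)) (u t)).2) := fun t ht => by
    have ht := Finset.mem_Ico.1 ht
    have := pricingAlgorithm_eq_ucbRound (B := B) (δ := δ) (orc := orc) (sel := sel)
      (vstar := vstar) (x := x) (e := e) (u := u) (t := t) hk hkρ hTe (by omega) (by omega)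
    rw [← hpol, ← hv, ← hn, ← hN, ← ha] at this
    simp only [hz, roundRec, Rec.sale]
    rw [this]
  -- Fallback rounds with a uniform price carry layer `0`, so they never enter the data of an arm at
  -- a genuine layer.
  have hprice : ∀ t ∈ Finset.Ico a (a + n), 1 ≤ (z t).layer →
      (z t).price = armPrice B v N (z t).ctx (z t).arm := fun t ht hl => by
    rw [hround t ht] at hl ⊢
    simp only [Rec.layer, Rec.price, Rec.ctx, Rec.arm, ucbRound] at hl ⊢
    split_ifs at hl ⊢ with h
    · rfl
    · simp at hl
  have hmean : ∀ t ∈ Finset.Ico a (a + n), ∀ s ∈ Finset.Icc 1 S, ∀ j ∈ Finset.Icc 1 N,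
      |sampleMean a (history pol vstar x e u t) s j - (1 - F (midpoint B (supNorm v) N j))| ≤
        radius a N n δ (history pol vstar x e u t) s j + L * err := fun t ht s hs j hj => by
    refine abs_sampleMean_sub_le hF.mem_Icc hL0 hF.lipschitz herr herr0 (fun τ hτ => ?_)
      (fun hpos => ?_)
    · simp only [armRounds, Finset.mem_filter, Finset.mem_univ, true_and, history_apply] at hτ ⊢
      have h1 := Finset.mem_Ico.1 ht
      have h2 := τ.2
      have := hprice τ (Finset.mem_Ico.2 ⟨hτ.1, by omega⟩) (by
        have h3 := (Finset.mem_Icc.1 hs).1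
        rw [hz, hτ.2.1]; exact h3)
      rw [hz, hτ.2.2] at this
      exact this
    · rw [← hS, ← hΛ]
      exact hdev t ht s hs j hj _ rfl hpos
  have hspec := fun t (ht : t ∈ Finset.Ico a (a + n)) =>
    hF.ucbRound_spec hB hL0 hopt hN1 (hS ▸ hS1) (hvM (x t)) herr
      (hsel t (history pol vstar x e u t) (x t)) (hu t) (by rw [← hS]; exact hmean t ht)
  have hposted : ∀ t ∈ Finset.Ico a (a + n), postedPrice pol vstar x e u t =
      (ucbRound a N n B δ v (history pol vstar x e u t) (x t)
        (sel t (history pol vstar x e u t) (x t)) (u t)).1 := fun t ht =>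
    congrArg Rec.price (hround t ht)
  have hlayer : ∀ t ∈ Finset.Ico a (a + n), (z t).layer =
      (ucbRound a N n B δ v (history pol vstar x e u t) (x t)
        (sel t (history pol vstar x e u t) (x t)) (u t)).2.1 := fun t ht =>
    congrArg Rec.layer (hround t ht)
  have harm : ∀ t ∈ Finset.Ico a (a + n), (z t).arm =
      (ucbRound a N n B δ v (history pol vstar x e u t) (x t)
        (sel t (history pol vstar x e u t) (x t)) (u t)).2.2 := fun t ht =>
    congrArg Rec.arm (hround t ht)
  simp only [← hS] at hspec
  have hw : (B + 2 * supNorm v) / N ≤ (3 * B + 2 * err) / N :=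
    div_le_div_of_nonneg_right (by linarith) hN0.le
  have hb0 : 0 ≤ 4 * (B * (L * err)) * S := by positivity
  have hsum := sum_layer_weights_le (z := z) (a := a) (n := n) (S := S) (N := N) hθ hθ1 hΛ0
    (fun t ht hl => by
      rw [harm t ht]
      rw [hlayer t ht] at hl ⊢
      rcases hspec t ht with h | h
      · omega
      · exact ⟨h.2.1, h.2.2.1⟩)
    (fun t ht hl hlS hpos => by
      have hrad : (2 : ℝ) ^ (-((z t).layer : ℤ)) < radius a N n δ (history pol vstar x e u t)
          (z t).layer (z t).arm := by
        rw [harm t ht]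
        rw [hlayer t ht] at hl hlS ⊢
        rcases hspec t ht with h | h
        · omega
        · exact h.2.2.2.1 hlS
      rw [history_eq, ← hz, radius, card_armRounds, if_neg hpos.ne', ← hS, ← hΛ] at hrad
      exact hrad.trans_le (min_le_left _ _))
  calc _ ≤ ∑ t ∈ Finset.Ico a (a + n), (((3 * B + 2 * err) / N + 4 * (B * (L * err)) * S) +
        8 * B * (if 1 ≤ (z t).layer then (2 : ℝ) ^ (-((z t).layer : ℤ)) else 0)) := by
        refine Finset.sum_le_sum fun t ht => ?_
        rw [hposted t ht, hlayer t ht]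
        rcases hspec t ht with h | h
        · rw [if_neg (by omega)]
          linarith [h.2]
        · rw [if_pos h.1]
          linarith [h.2.2.2.2]
    _ ≤ _ := by
        rw [Finset.sum_add_distrib, ← Finset.mul_sum, ← Finset.sum_filter, Finset.sum_const,
          Nat.card_Ico, Nat.add_sub_cancel_left, nsmul_eq_mul]
        exact add_le_add le_rfl (mul_le_mul_of_nonneg_left hsum (by positivity))

end Phase

/-! ### Numerical estimates: exploration length, numbers of arms and layers, confidence level. -/

section Numerics

lemma one_le_rpow_mul_rpow {ρ α l : ℝ} (hρ : 1 ≤ ρ) (hα : 0 < α) (hl : 1 ≤ l) :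
    1 ≤ ρ ^ (1 / (2 + α)) * l ^ (2 / (2 + α)) :=
  one_le_mul_of_one_le_of_one_le (Real.one_le_rpow hρ (by positivity))
    (Real.one_le_rpow hl (by positivity))

lemma explorationLength_pos {ρ α : ℝ} (hρ : 1 ≤ ρ) (hα : 0 < α) (k : ℕ) :
    0 < explorationLength ρ α k := by
  have hl : (1 : ℝ) ≤ episodeLength k := by exact_mod_cast episodeLength_pos k
  refine lt_min (Nat.ceil_pos.2 ?_) (episodeLength_pos k)
  linarith [one_le_rpow_mul_rpow hρ hα hl]

/-- Rounding up at most doubles a quantity that is at least `1`. -/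
lemma explorationLength_le_two_mul {ρ α : ℝ} (hρ : 1 ≤ ρ) (hα : 0 < α) (k : ℕ) :
    (explorationLength ρ α k : ℝ) ≤
      2 * (ρ ^ (1 / (2 + α)) * (episodeLength k : ℝ) ^ (2 / (2 + α))) := by
  have hl : (1 : ℝ) ≤ episodeLength k := by exact_mod_cast episodeLength_pos k
  have h1 := one_le_rpow_mul_rpow hρ hα hl
  have h2 : (explorationLength ρ α k : ℝ) ≤
      (⌈ρ ^ (1 / (2 + α)) * (episodeLength k : ℝ) ^ (2 / (2 + α))⌉₊ : ℝ) := by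
    exact_mod_cast min_le_left _ _
  have h3 := Nat.ceil_lt_add_one (a := ρ ^ (1 / (2 + α)) *
    (episodeLength k : ℝ) ^ (2 / (2 + α))) (by linarith)
  linarith

/-- The accuracy of the oracle after an exploration phase that does not exhaust the episode. -/
lemma oracle_error_le {ρ α : ℝ} (hρ : 1 ≤ ρ) (hα : 0 < α) {k : ℕ}
    (hlt : explorationLength ρ α k < episodeLength k) :
    Real.sqrt (ρ / (explorationLength ρ α k : ℝ) ^ α) ≤ 1 ∧
      episodeLength k * Real.sqrt (ρ / (explorationLength ρ α k : ℝ) ^ α) ≤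
        ρ ^ (1 / (2 + α)) * (episodeLength k : ℝ) ^ (2 / (2 + α)) := by
  have hl : (1 : ℝ) ≤ episodeLength k := by exact_mod_cast episodeLength_pos k
  have h1 := one_le_rpow_mul_rpow hρ hα hl
  have hTe : explorationLength ρ α k =
      ⌈ρ ^ (1 / (2 + α)) * (episodeLength k : ℝ) ^ (2 / (2 + α))⌉₊ := by
    unfold explorationLength at hlt ⊢
    exact min_eq_left (by omega)
  have hy : ρ ^ (1 / (2 + α)) * (episodeLength k : ℝ) ^ (2 / (2 + α)) ≤
      explorationLength ρ α k := hTe ▸ Nat.le_ceil _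
  have hlt' : (explorationLength ρ α k : ℝ) < episodeLength k := by exact_mod_cast hlt
  -- This identity defines the balance: with `y ^ (2 + α) = ρ ℓ²`, one has `ρ / y ^ α = (y / ℓ)²`,
  -- so `y` samples give error at most `y / ℓ`.
  have hpow : (ρ ^ (1 / (2 + α)) * (episodeLength k : ℝ) ^ (2 / (2 + α))) ^ (2 + α) =
      ρ * (episodeLength k : ℝ) ^ 2 := by
    rw [Real.mul_rpow (by positivity) (by positivity), ← Real.rpow_mul (by linarith),
      ← Real.rpow_mul (by linarith), div_mul_cancel₀ _ (by linarith),
      div_mul_cancel₀ _ (by linarith), Real.rpow_one, Real.rpow_two]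
  set y := ρ ^ (1 / (2 + α)) * (episodeLength k : ℝ) ^ (2 / (2 + α))
  set l : ℝ := (episodeLength k : ℝ)
  set Te : ℝ := (explorationLength ρ α k : ℝ)
  have hy0 : 0 < y := by linarith
  have hl0 : 0 < l := by linarith
  have herr : Real.sqrt (ρ / Te ^ α) ≤ y / l := by
    refine Real.sqrt_le_iff.2 ⟨by positivity, ?_⟩
    have hya : 0 < y ^ α := by positivity
    calc ρ / Te ^ α ≤ ρ / y ^ α := div_le_div_of_nonneg_left (by linarith) hya
          (Real.rpow_le_rpow hy0.le hy hα.le)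
      _ = (y / l) ^ 2 := by
        rw [Real.rpow_add hy0, Real.rpow_two] at hpow
        field_simp
        linarith
  constructor
  · exact herr.trans ((div_le_one hl0).2 (by linarith))
  · calc l * Real.sqrt (ρ / Te ^ α) ≤ l * (y / l) := mul_le_mul_of_nonneg_left herr hl0.le
      _ = y := by field_simp

lemma rpow_two_thirds_eq {n : ℝ} (hn : 0 < n) :
    n ^ (-(1 / 3) : ℝ) * n = n ^ (2 / 3 : ℝ) ∧
      n ^ (1 / 3 : ℝ) / n ^ (-(1 / 3) : ℝ) = n ^ (2 / 3 : ℝ) := by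
  constructor
  · nth_rewrite 2 [← Real.rpow_one n]
    rw [← Real.rpow_add hn]; norm_num
  · rw [← Real.rpow_sub hn]; norm_num

lemma one_le_numLayers {n : ℕ} (hn : 2 ≤ n) : 1 ≤ numLayers n := by
  refine Nat.one_le_ceil_iff.2 ?_
  have : 0 < Real.logb 2 n := Real.logb_pos (by norm_num) (by exact_mod_cast hn)
  linarith

/-- The number of layers gives the stronger decay `n ^ (-1/2)`. The exponent `-1/3` is the one that
matches the threshold `θ`. -/
lemma two_zpow_neg_numLayers_le {n : ℕ} (hn : 2 ≤ n) :
    (2 : ℝ) ^ (-(numLayers n : ℤ)) ≤ (n : ℝ) ^ (-(1 / 3) : ℝ) := by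
  have hn2 : (2 : ℝ) ≤ n := by exact_mod_cast hn
  have hn0 : (0 : ℝ) < n := by linarith
  have h1 : (1 / 2 : ℝ) * Real.logb 2 n ≤ numLayers n := Nat.le_ceil _
  have h0 : 0 < Real.logb 2 n := Real.logb_pos (by norm_num) (by linarith)
  calc (2 : ℝ) ^ (-(numLayers n : ℤ)) = (2 : ℝ) ^ (-(numLayers n : ℝ)) := by
        rw [← Real.rpow_intCast]; push_cast; rfl
    _ ≤ (2 : ℝ) ^ (Real.logb 2 n * (-(1 / 3))) :=
        Real.rpow_le_rpow_of_exponent_le (by norm_num) (by linarith)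
    _ = (n : ℝ) ^ (-(1 / 3) : ℝ) := by
        rw [Real.rpow_mul (by norm_num), Real.rpow_logb (by norm_num) (by norm_num) hn0]

lemma logb_two_le {y E : ℝ} (hE : 0 ≤ E) (hy : Real.log y ≤ E) :
    Real.logb 2 y ≤ 3 / 2 * E := by
  rw [Real.logb, div_le_iff₀ (Real.log_pos (by norm_num))]
  have := Real.log_two_gt_d9
  nlinarith

lemma one_le_log_div {T δ : ℝ} (hT : 2 ≤ T) (hδ : 0 < δ) (hδ2 : δ ≤ 1 / 2) :
    4 ≤ T / δ ∧ 1 ≤ Real.log (T / δ) := by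
  have h4 : 4 ≤ T / δ := by rw [le_div_iff₀ hδ]; linarith
  refine ⟨h4, ?_⟩
  rw [Real.le_log_iff_exp_le (by linarith)]
  linarith [Real.exp_one_lt_d9]

lemma numArms_bounds {n : ℕ} {δ : ℝ} (hn : 2 ≤ n) (hδ : 0 < δ) (hδ2 : δ ≤ 1 / 2) :
    1 ≤ numArms n δ ∧ (numArms n δ : ℝ) ≤ 2 * (n : ℝ) ^ (1 / 3 : ℝ) ∧
      (n : ℝ) / numArms n δ ≤ (n : ℝ) ^ (2 / 3 : ℝ) * Real.log (n / δ) := by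
  have hn2 : (2 : ℝ) ≤ n := by exact_mod_cast hn
  have hn0 : (0 : ℝ) < n := by linarith
  have hl := (one_le_log_div hn2 hδ hδ2).2
  unfold numArms
  set l := Real.log (n / δ)
  have hl1 : 1 ≤ l ^ (1 / 3 : ℝ) := Real.one_le_rpow hl (by norm_num)
  have hl2 : l ^ (1 / 3 : ℝ) ≤ l := by
    calc l ^ (1 / 3 : ℝ) ≤ l ^ (1 : ℝ) := Real.rpow_le_rpow_of_exponent_le hl (by norm_num)
      _ = l := Real.rpow_one l
  have hn1 : 1 ≤ (n : ℝ) ^ (1 / 3 : ℝ) := Real.one_le_rpow (by linarith) (by norm_num)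
  have hq0 : 0 < (n : ℝ) ^ (1 / 3 : ℝ) / l ^ (1 / 3 : ℝ) := by positivity
  have hq1 : (n : ℝ) ^ (1 / 3 : ℝ) / l ^ (1 / 3 : ℝ) ≤ (n : ℝ) ^ (1 / 3 : ℝ) :=
    div_le_self (by linarith) hl1
  have hc1 := Nat.le_ceil ((n : ℝ) ^ (1 / 3 : ℝ) / l ^ (1 / 3 : ℝ))
  have hc2 := Nat.ceil_lt_add_one hq0.le
  refine ⟨Nat.one_le_ceil_iff.2 hq0, by linarith, ?_⟩
  have h23 : (n : ℝ) ^ (2 / 3 : ℝ) * (n : ℝ) ^ (1 / 3 : ℝ) = n := by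
    rw [← Real.rpow_add hn0]; norm_num
  calc (n : ℝ) / ⌈(n : ℝ) ^ (1 / 3 : ℝ) / l ^ (1 / 3 : ℝ)⌉₊ ≤
        n / ((n : ℝ) ^ (1 / 3 : ℝ) / l ^ (1 / 3 : ℝ)) :=
        div_le_div_of_nonneg_left hn0.le hq0 hc1
    _ = (n : ℝ) ^ (2 / 3 : ℝ) * l ^ (1 / 3 : ℝ) := by
        nth_rewrite 1 [← h23]
        field_simp
    _ ≤ _ := mul_le_mul_of_nonneg_left hl2 (by positivity)

/-- Four terms are bounded separately: discretization (`t1`), regression bias (`t2`), layers of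
small weight (`t3`) and confidence widths (`t4`). The constant is `307 = 3 + 8 (2 + 36)`. -/
lemma phase_bound_arith {n B L err Φ S N E Λ θ q n13 n23 ln : ℝ} (hB : 0 < B) (hL : 0 ≤ L)
    (hn0 : 0 < n) (herr0 : 0 ≤ err) (herr1 : err ≤ 1) (herr : n * err ≤ Φ) (hE : 1 ≤ E)
    (hS0 : 0 ≤ S) (hSE : S ≤ 2 * E) (hN0 : 0 < N) (hN2 : N ≤ 2 * n13) (hN3 : n / N ≤ n23 * ln)
    (hlognδ : ln ≤ E) (hΛ0 : 0 ≤ Λ) (hΛ : Λ ≤ 4 * E) (hθ0 : 0 < θ) (hzS : q ≤ θ)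
    (hr1 : θ * n = n23) (hr2 : n13 / θ = n23) (hn130 : 0 < n13) (hn230 : 0 < n23)
    (hn23 : n23 ≤ Φ) :
    n * ((3 * B + 2 * err) / N + 4 * (B * (L * err)) * S) +
        8 * B * ((q + θ) * n + S * N * ((1 + 2 * Λ) / θ)) ≤
      (307 * B + 2 + 8 * (B * L)) * (E ^ 2 * Φ) := by
  have hΦ0 : 0 ≤ Φ := by linarith
  have hE2 : E ≤ E ^ 2 := by nlinarith
  have hEΦ : E * Φ ≤ E ^ 2 * Φ := mul_le_mul_of_nonneg_right hE2 hΦ0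
  have hΦE : Φ ≤ E ^ 2 * Φ := le_mul_of_one_le_left hΦ0 (by linarith)
  have t1 : n * ((3 * B + 2 * err) / N) ≤ (3 * B + 2) * (E ^ 2 * Φ) := by
    calc n * ((3 * B + 2 * err) / N) = (3 * B + 2 * err) * (n / N) := by ring
      _ ≤ (3 * B + 2) * (E * Φ) := by
        refine mul_le_mul (by linarith) ?_ (by positivity) (by positivity)
        calc n / N ≤ n23 * ln := hN3
          _ ≤ n23 * E := mul_le_mul_of_nonneg_left hlognδ hn230.le
          _ ≤ Φ * E := mul_le_mul_of_nonneg_right hn23 (by linarith)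
          _ = E * Φ := mul_comm _ _
      _ ≤ _ := mul_le_mul_of_nonneg_left hEΦ (by positivity)
  have t2 : n * (4 * (B * (L * err)) * S) ≤ 8 * (B * L) * (E ^ 2 * Φ) := by
    calc n * (4 * (B * (L * err)) * S) = 4 * (B * L) * ((n * err) * S) := by ring
      _ ≤ 4 * (B * L) * (Φ * (2 * E)) :=
        mul_le_mul_of_nonneg_left (mul_le_mul herr hSE (by linarith) hΦ0) (by positivity)
      _ = 8 * (B * L) * (E * Φ) := by ring
      _ ≤ _ := mul_le_mul_of_nonneg_left hEΦ (by positivity)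
  have t3 : (q + θ) * n ≤ 2 * (E ^ 2 * Φ) := by
    calc _ ≤ (θ + θ) * n := mul_le_mul_of_nonneg_right (by linarith) hn0.le
      _ = 2 * n23 := by rw [← hr1]; ring
      _ ≤ _ := by linarith
  have t4 : S * N * ((1 + 2 * Λ) / θ) ≤ 36 * (E ^ 2 * Φ) := by
    calc S * N * ((1 + 2 * Λ) / θ) ≤ (2 * E) * (2 * n13) * ((9 * E) / θ) := by
          refine mul_le_mul (mul_le_mul hSE hN2 (by linarith) (by linarith)) ?_
            (by positivity) (by positivity)
          exact div_le_div_of_nonneg_right (by linarith) hθ0.le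
      _ = 36 * (E ^ 2 * (n13 / θ)) := by ring
      _ = 36 * (E ^ 2 * n23) := by rw [hr2]
      _ ≤ _ := by
        have := mul_le_mul_of_nonneg_left hn23 (sq_nonneg E)
        linarith
  have t34 := mul_le_mul_of_nonneg_left (add_le_add t3 t4) (by positivity : 0 ≤ 8 * B)
  have hpos : 0 ≤ B * (E ^ 2 * Φ) := by positivity
  linarith

/-- The numerical form of the regret bound for a UCB phase. -/
lemma phase_bound_le {n T : ℕ} {B L δ err Φ : ℝ} (hB : 0 < B) (hL : 0 ≤ L) (hn : 2 ≤ n)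
    (hnT : n ≤ T) (hδ : 0 < δ) (hδ2 : δ ≤ 1 / 2) (herr0 : 0 ≤ err) (herr1 : err ≤ 1)
    (herr : n * err ≤ Φ) (hΦ : (T : ℝ) ^ (2 / 3 : ℝ) ≤ Φ) :
    0 ≤ Real.log (2 * numLayers n * numArms n δ * n / δ) ∧
    n * ((3 * B + 2 * err) / numArms n δ + 4 * (B * (L * err)) * numLayers n) +
        8 * B * (((2 : ℝ) ^ (-(numLayers n : ℤ)) + (n : ℝ) ^ (-(1 / 3) : ℝ)) * n +
          numLayers n * numArms n δ *
            ((1 + 2 * Real.log (2 * numLayers n * numArms n δ * n / δ)) /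
              (n : ℝ) ^ (-(1 / 3) : ℝ))) ≤
      (307 * B + 2 + 8 * (B * L)) * (Real.log (T / δ) ^ 2 * Φ) := by
  have hn2 : (2 : ℝ) ≤ n := by exact_mod_cast hn
  have hn0 : (0 : ℝ) < n := by linarith
  have hnT' : (n : ℝ) ≤ T := by exact_mod_cast hnT
  obtain ⟨hTδ, hE⟩ := one_le_log_div (hn2.trans hnT') hδ hδ2
  obtain ⟨hN1, hN2, hN3⟩ := numArms_bounds hn hδ hδ2
  have hS1 := one_le_numLayers hn
  have hzS := two_zpow_neg_numLayers_le hn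
  obtain ⟨hr1, hr2⟩ := rpow_two_thirds_eq hn0
  have hδn : (n : ℝ) ≤ n / δ := by rw [le_div_iff₀ hδ]; nlinarith
  have hnTδ : (n : ℝ) / δ ≤ T / δ := div_le_div_of_nonneg_right hnT' hδ.le
  have hlogn : Real.log n ≤ Real.log (T / δ) := Real.log_le_log hn0 (hδn.trans hnTδ)
  have hlognδ : Real.log (n / δ) ≤ Real.log (T / δ) := Real.log_le_log (by positivity) hnTδ
  have hn13 : (n : ℝ) ^ (1 / 3 : ℝ) ≤ n := by
    calc (n : ℝ) ^ (1 / 3 : ℝ) ≤ (n : ℝ) ^ (1 : ℝ) :=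
          Real.rpow_le_rpow_of_exponent_le (by linarith) (by norm_num)
      _ = n := Real.rpow_one _
  have hn23 : (n : ℝ) ^ (2 / 3 : ℝ) ≤ Φ :=
    (Real.rpow_le_rpow hn0.le hnT' (by norm_num)).trans hΦ
  have hSn : (numLayers n : ℝ) ≤ n := by
    have : numLayers n ≤ n := by
      refine Nat.ceil_le.2 ?_
      have h1 := logb_two_le (y := n) (E := n) (by linarith)
        ((Real.log_le_sub_one_of_pos hn0).trans (by linarith))
      linarith
    exact_mod_cast this
  have hSE : (numLayers n : ℝ) ≤ 2 * Real.log (T / δ) := by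
    have h0 : 0 < Real.logb 2 n := Real.logb_pos (by norm_num) (by linarith)
    have h1 : (numLayers n : ℝ) < 1 / 2 * Real.logb 2 n + 1 :=
      Nat.ceil_lt_add_one (by linarith)
    have h2 := logb_two_le (by linarith) hlogn
    linarith
  set S : ℝ := (numLayers n : ℝ) with hSdef
  set N : ℝ := (numArms n δ : ℝ) with hNdef
  set E := Real.log (T / δ) with hEdef
  have hS1' : 1 ≤ S := by rw [hSdef]; exact_mod_cast hS1
  have hN1' : 1 ≤ N := by rw [hNdef]; exact_mod_cast hN1
  set n13 := (n : ℝ) ^ (1 / 3 : ℝ)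
  set n23 := (n : ℝ) ^ (2 / 3 : ℝ)
  set θ := (n : ℝ) ^ (-(1 / 3) : ℝ)
  have hn130 : 0 < n13 := by positivity
  have hn230 : 0 < n23 := by positivity
  have hθ0 : 0 < θ := by positivity
  have hΛarg : 1 ≤ 2 * S * N * n / δ := by
    rw [le_div_iff₀ hδ]
    have : 1 ≤ S * N * n := one_le_mul_of_one_le_of_one_le
      (one_le_mul_of_one_le_of_one_le hS1' hN1') (by linarith)
    nlinarith
  have hΛ0 : 0 ≤ Real.log (2 * S * N * n / δ) := Real.log_nonneg hΛarg
  have hΛ : Real.log (2 * S * N * n / δ) ≤ 4 * E := by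
    have h1 : 2 * S * N * n / δ ≤ (T / δ) ^ 4 := by
      have hnn : (n : ℝ) ≤ T / δ := hδn.trans hnTδ
      have a1 : S * N ≤ n * (2 * n) := mul_le_mul hSn (by linarith) (by linarith) hn0.le
      -- Here `2 S N ≤ 4 n²`, and `4 ≤ T / δ` absorbs the numerical factor into the third power.
      have a2 : 2 * (S * N) ≤ (T / δ) ^ 3 := by
        have : (n : ℝ) * n ≤ (T / δ) * (T / δ) := mul_le_mul hnn hnn hn0.le (by linarith)
        nlinarith
      calc 2 * S * N * n / δ = 2 * (S * N) * (n / δ) := by ring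
        _ ≤ (T / δ) ^ 3 * (T / δ) := mul_le_mul a2 hnTδ (by positivity) (by positivity)
        _ = (T / δ) ^ 4 := by ring
    calc _ ≤ Real.log ((T / δ) ^ 4) := Real.log_le_log (by linarith) h1
      _ = 4 * E := by rw [Real.log_pow, hEdef]; norm_num
  refine ⟨hΛ0, ?_⟩
  exact phase_bound_arith hB hL hn0 herr0 herr1 herr hE (by linarith) hSE (by linarith) hN2 hN3
    hlognδ hΛ0 hΛ hθ0 hzS hr1 hr2 hn130 hn230 hn23

end Numerics

/-! ### Splitting the horizon into warm-up and episodes. -/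

section Decomposition

lemma firstEpisode_pos {ρ : ℝ} (hρ : 1 < ρ) : 1 ≤ firstEpisode ρ :=
  Nat.one_le_ceil_iff.2 (Real.logb_pos (by norm_num) hρ)

lemma episodeLength_firstEpisode_le {ρ : ℝ} (hρ : 1 < ρ) :
    (episodeLength (firstEpisode ρ) : ℝ) ≤ ρ := by
  have h0 : 0 < Real.logb 2 ρ := Real.logb_pos (by norm_num) hρ
  have h1 : (firstEpisode ρ : ℝ) < Real.logb 2 ρ + 1 := Nat.ceil_lt_add_one h0.le
  have h2 : ((firstEpisode ρ - 1 : ℕ) : ℝ) ≤ Real.logb 2 ρ := by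
    rw [Nat.cast_sub (firstEpisode_pos hρ)]
    push_cast
    linarith
  calc (episodeLength (firstEpisode ρ) : ℝ) = (2 : ℝ) ^ ((firstEpisode ρ - 1 : ℕ) : ℝ) := by
        rw [Real.rpow_natCast]; simp [episodeLength]
    _ ≤ (2 : ℝ) ^ Real.logb 2 ρ := Real.rpow_le_rpow_of_exponent_le (by norm_num) h2
    _ = ρ := Real.rpow_logb (by norm_num) (by norm_num) (by linarith)

/-- The minimum is bounded by a weighted geometric mean. This fits the warm-up cost into the first
term of the maximum even when `ρ` exceeds `T`. -/
lemma min_le_rpow_mul_rpow {ρ T : ℝ} (hρ : 0 < ρ) (hT : 0 < T) :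
    min T ρ ≤ ρ ^ (1 / 3 : ℝ) * T ^ (2 / 3 : ℝ) := by
  have hm : 0 < min T ρ := lt_min hT hρ
  calc min T ρ = min T ρ ^ (1 / 3 : ℝ) * min T ρ ^ (2 / 3 : ℝ) := by
        rw [← Real.rpow_add hm]; norm_num
    _ ≤ _ := mul_le_mul (Real.rpow_le_rpow hm.le (min_le_right _ _) (by norm_num))
        (Real.rpow_le_rpow hm.le (min_le_left _ _) (by norm_num)) (by positivity) (by positivity)

lemma episodeLength_lt {T k : ℕ} (hT : 2 ≤ T) (hk : 1 ≤ k) (hkT : k ≤ ⌈Real.logb 2 T⌉₊) :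
    episodeLength k < T := by
  have h1 : ((k - 1 : ℕ) : ℝ) < Real.logb 2 T := Nat.lt_ceil.1 (by omega)
  have hT0 : (0 : ℝ) < T := by exact_mod_cast (by omega : 0 < T)
  have h2 : (2 : ℝ) ^ ((k - 1 : ℕ) : ℝ) < T := by
    calc _ < (2 : ℝ) ^ Real.logb 2 T := Real.rpow_lt_rpow_of_exponent_lt (by norm_num) h1
      _ = T := Real.rpow_logb (by norm_num) (by norm_num) hT0
  rw [Real.rpow_natCast] at h2
  unfold episodeLength
  exact_mod_cast h2

lemma mem_episode_of_le {t : ℕ} (ht : 1 ≤ t) :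
    1 ≤ episodeOf t ∧ t ∈ Finset.Ico (episodeLength (episodeOf t))
      (2 * episodeLength (episodeOf t)) := by
  have h1 : 1 ≤ episodeOf t := by simp [episodeOf]
  refine ⟨h1, Finset.mem_Ico.2 ⟨?_, ?_⟩⟩
  · exact Nat.pow_log_le_self 2 (by omega)
  · rw [two_mul_episodeLength h1]
    exact Nat.lt_pow_succ_log_self (by norm_num) t

lemma episodeOf_mem_Icc {ρ : ℝ} {t T : ℕ} (hρ : 1 < ρ)
    (ht : episodeLength (firstEpisode ρ) ≤ t) (htT : t < T) :
    episodeOf t ∈ Finset.Icc (firstEpisode ρ) ⌈Real.logb 2 T⌉₊ := by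
  have ht1 : 1 ≤ t := (episodeLength_pos _).trans_le ht
  have hk := firstEpisode_pos hρ
  obtain ⟨h1, h2⟩ := mem_episode_of_le ht1
  obtain ⟨h3, h4⟩ := Finset.mem_Ico.1 h2
  refine Finset.mem_Icc.2 ⟨?_, ?_⟩
  · have h5 : firstEpisode ρ - 1 < episodeOf t := by
      rw [two_mul_episodeLength h1] at h4
      exact (Nat.pow_lt_pow_iff_right (by norm_num : 1 < 2)).1 (ht.trans_lt h4)
    omega
  · have hT0 : (0 : ℝ) < T := by exact_mod_cast (by omega : 0 < T)
    have h5 : ((episodeOf t - 1 : ℕ) : ℝ) < Real.logb 2 T := by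
      rw [Real.lt_logb_iff_rpow_lt (by norm_num) hT0, Real.rpow_natCast]
      have : episodeLength (episodeOf t) < T := by omega
      unfold episodeLength at this
      exact_mod_cast this
    have := Nat.lt_ceil.2 h5
    omega

/-- The regret is at most the regret of the warm-up plus that of the complete episodes. -/
lemma sum_range_le_sum_episodes {ρ B : ℝ} (hρ : 1 < ρ) (hB : 0 ≤ B) {T : ℕ} (hT : 0 < T)
    {reg : ℕ → ℝ} (h0 : ∀ t, 0 ≤ reg t) (hreg : ∀ t, reg t ≤ B) :
    ∑ t ∈ Finset.range T, reg t ≤ B * (ρ ^ (1 / 3 : ℝ) * (T : ℝ) ^ (2 / 3 : ℝ)) +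
      ∑ k ∈ Finset.Icc (firstEpisode ρ) ⌈Real.logb 2 T⌉₊,
        ∑ t ∈ Finset.Ico (episodeLength k) (2 * episodeLength k), reg t := by
  set w := episodeLength (firstEpisode ρ) with hw
  rw [← Finset.sum_filter_add_sum_filter_not (Finset.range T) (fun t => t < w)]
  refine add_le_add ?_ ?_
  · have hcard : (((Finset.range T).filter fun t => t < w).card : ℝ) ≤ min (T : ℝ) ρ := by
      refine le_min ?_ (le_trans ?_ (episodeLength_firstEpisode_le hρ))
      · exact_mod_cast (Finset.card_filter_le _ _).trans (by simp)
      · have : (Finset.range T).filter (fun t => t < w) ⊆ Finset.range w := fun t ht =>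
          Finset.mem_range.2 (Finset.mem_filter.1 ht).2
        exact_mod_cast (Finset.card_le_card this).trans (by simp [hw])
    have hT0 : (0 : ℝ) < T := by exact_mod_cast hT
    calc _ ≤ ((Finset.range T).filter fun t => t < w).card • B :=
          Finset.sum_le_card_nsmul _ _ _ fun t _ => hreg t
      _ = B * ((Finset.range T).filter fun t => t < w).card := by rw [nsmul_eq_mul, mul_comm]
      _ ≤ _ := mul_le_mul_of_nonneg_left
          (hcard.trans (min_le_rpow_mul_rpow (by linarith) hT0)) hB
  · have hmem : ∀ t ∈ (Finset.range T).filter (fun t => ¬ t < w), w ≤ t ∧ t < T := fun t ht => by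
      have := Finset.mem_filter.1 ht
      exact ⟨not_lt.1 this.2, Finset.mem_range.1 this.1⟩
    rw [← Finset.sum_fiberwise_of_maps_to (g := episodeOf)
      (t := Finset.Icc (firstEpisode ρ) ⌈Real.logb 2 T⌉₊)
      fun t ht => episodeOf_mem_Icc hρ (hmem t ht).1 (hmem t ht).2]
    refine Finset.sum_le_sum fun k _ => ?_
    -- The horizon may cut the last episode short; nonnegative summands allow the whole episode to
    -- be counted.
    refine Finset.sum_le_sum_of_subset_of_nonneg (fun t ht => ?_) fun t _ _ => h0 t
    obtain ⟨ht', rfl⟩ := Finset.mem_filter.1 ht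
    exact (mem_episode_of_le ((episodeLength_pos _).trans_le (hmem t ht').1)).2

end Decomposition

/-! ### The regret of a complete episode. -/

section Episode

variable {X : Type*} {F : ℝ → ℝ} {vstar pstar : X → ℝ} {B L ρ δ α : ℝ}
  {orc : Oracle X} {sel : Selector X} {x : ℕ → X} {e u : ℕ → ℝ} {k T : ℕ}

/-- No confidence event is needed: the maximizer of the upper confidence bound always survives, so
the action set never becomes empty. Hence UCB prices are positive in every realization. -/
lemma traverse_mem {t start N n : ℕ} {v : X → ℝ} {h : Fin t → Rec X} {x : X}
    {pick : Finset ℕ → ℕ} (hB : 0 < B) (hpick : ∀ A : Finset ℕ, A.Nonempty → pick A ∈ A)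
    (fuel : ℕ) : ∀ (s : ℕ) (A : Finset ℕ), A.Nonempty →
      (traverse start N n B δ v h x pick fuel s A).2 ∈ A := by
  classical
  induction fuel with
  | zero =>
    intro s A hA
    obtain ⟨i, hi, hmax⟩ := A.exists_max_image (ucb start N n B δ v h x s) hA
    exact Finset.filter_subset _ _ (hpick (bestArms start N n B δ v h x s A)
      ⟨i, by simp only [bestArms, Finset.mem_filter]; exact ⟨hi, hmax⟩⟩)
  | succ fuel ih =>
    intro s A hA
    simp only [traverse]
    split_ifs with hf
    · exact Finset.filter_subset _ _ (hpick _ hf)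
    · obtain ⟨i, hi, hmax⟩ := A.exists_max_image (ucb start N n B δ v h x s) hA
      have hpos : 0 < B * (2 : ℝ) ^ (1 - (s : ℤ)) := by positivity
      refine Finset.filter_subset _ _ (ih (s + 1) (survivingArms start N n B δ v h x s A) ⟨i, ?_⟩)
      simp only [survivingArms, Finset.mem_filter]
      exact ⟨hi, fun l hl => by linarith [hmax l hl]⟩

lemma ucbRound_price_nonneg {t start N n : ℕ} {v : X → ℝ} {h : Fin t → Rec X} {x : X}
    {pick : Finset ℕ → ℕ} (hB : 0 < B) (hpick : ∀ A : Finset ℕ, A.Nonempty → pick A ∈ A)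
    {u : ℝ} (hu : 0 ≤ u) : 0 ≤ (ucbRound start N n B δ v h x pick u).1 := by
  unfold ucbRound
  split_ifs with hne
  · have hmem := traverse_mem (start := start) (n := n) (δ := δ) (h := h) (x := x) (v := v) (N := N)
      hB hpick (numLayers n - 1) 1 _ hne
    simp only [initialArms, Finset.mem_filter] at hmem
    exact hmem.2.1.le
  · exact hu

lemma pricingAlgorithm_price_nonneg {Te : ℕ → ℕ} (hB : 0 < B)
    (hsel : ∀ t h x A, A.Nonempty → sel t h x A ∈ A) {t : ℕ} (h : Fin t → Rec X) (x : X) {u : ℝ}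
    (hu : 0 ≤ u) : 0 ≤ (pricingAlgorithm B ρ δ Te orc sel t h x u).1 := by
  unfold pricingAlgorithm
  simp only
  split_ifs
  · exact hu
  · exact ucbRound_price_nonneg hB (hsel t h x) hu
  · exact hu

/-- The regret of an episode on the event that the predictor and the confidence radii are valid. -/
lemma IsRegularMarket.episode_regret_le (hF : IsRegularMarket F vstar B L) (hB : 0 < B)
    (hL0 : 0 ≤ L) (hopt : IsOptimalPricing F vstar pstar)
    (hsel : ∀ t h x A, A.Nonempty → sel t h x A ∈ A) (hu : ∀ t, 0 ≤ u t)
    (hρ : 1 < ρ) (hα : 0 < α) (hδ : 0 < δ) (hδ2 : δ ≤ 1 / 2)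
    (hk : 1 ≤ k) (hkρ : firstEpisode ρ ≤ k) (hT : 2 ≤ T) (hkT : episodeLength k < T)
    {v : X → ℝ} {Te a n : ℕ} (hTe : Te = explorationLength ρ α k)
    (ha : a = episodeLength k + Te) (hn : n = episodeLength k - Te)
    (hv : v = orc Te fun i : Fin Te => (x (episodeLength k + i),
      decide (u (episodeLength k + i) ≤
        vstar (x (episodeLength k + i)) + e (episodeLength k + i))))
    (herr : ∀ y, |v y - vstar y| ≤ Real.sqrt (ρ / (Te : ℝ) ^ α))
    (hdev : ∀ t ∈ Finset.Ico a (a + n), ∀ s ∈ Finset.Icc 1 (numLayers n),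
      ∀ j ∈ Finset.Icc 1 (numArms n δ),
      ∀ h, h = history (pricingAlgorithm B ρ δ (explorationLength ρ α) orc sel) vstar x e u t →
        0 < (armRounds a h s j).card → |∑ τ ∈ armRounds a h s j, excess F vstar (h τ)| ≤
          (armRounds a h s j).card * Real.sqrt (2 *
            Real.log (2 * numLayers n * numArms n δ * n / δ) / (armRounds a h s j).card)) :
    ∑ t ∈ Finset.Ico (episodeLength k) (2 * episodeLength k),
      (revenue F (vstar (x t)) (pstar (x t)) - revenue F (vstar (x t))
        (postedPrice (pricingAlgorithm B ρ δ (explorationLength ρ α) orc sel) vstar x e u t)) ≤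
      (309 * B + 2 + 8 * (B * L)) * (Real.log (T / δ) ^ 2 *
        max (ρ ^ (1 / 3 : ℝ) * (T : ℝ) ^ (2 / 3 : ℝ))
          (ρ ^ (1 / (2 + α)) * (T : ℝ) ^ (2 / (2 + α)))) := by
  set Φ := max (ρ ^ (1 / 3 : ℝ) * (T : ℝ) ^ (2 / 3 : ℝ))
          (ρ ^ (1 / (2 + α)) * (T : ℝ) ^ (2 / (2 + α))) with hΦ
  set pol := pricingAlgorithm B ρ δ (explorationLength ρ α) orc sel with hpol
  set l := episodeLength k with hl
  have hTeℓ : Te ≤ l := hTe ▸ explorationLength_le ρ α k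
  have hT2 : (2 : ℝ) ≤ T := by exact_mod_cast hT
  have hlT : (l : ℝ) ≤ T := by exact_mod_cast hkT.le
  have hl0 : (0 : ℝ) ≤ l := Nat.cast_nonneg _
  obtain ⟨-, hE⟩ := one_le_log_div hT2 hδ hδ2
  have hX2 : ρ ^ (1 / (2 + α)) * (l : ℝ) ^ (2 / (2 + α)) ≤ Φ :=
    (mul_le_mul_of_nonneg_left (Real.rpow_le_rpow hl0 hlT (by positivity))
      (by positivity)).trans (le_max_right _ _)
  have hX1 : (T : ℝ) ^ (2 / 3 : ℝ) ≤ Φ :=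
    (le_mul_of_one_le_left (by positivity) (Real.one_le_rpow hρ.le (by norm_num))).trans
      (le_max_left _ _)
  have hΦ1 : 1 ≤ Φ := (Real.one_le_rpow (by linarith) (by norm_num)).trans hX1
  have hTeΦ : (Te : ℝ) ≤ 2 * Φ := by
    have := explorationLength_le_two_mul hρ.le hα k
    rw [← hTe, ← hl] at this
    linarith
  have hΦE : Φ ≤ Real.log (T / δ) ^ 2 * Φ :=
    le_mul_of_one_le_left (by linarith) (one_le_pow₀ hE)
  have hBΦE := mul_le_mul_of_nonneg_left hΦE hB.le
  have hsplit : 2 * l = a + n := by omega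
  have hreg : ∀ t, revenue F (vstar (x t)) (pstar (x t)) - revenue F (vstar (x t))
      (postedPrice pol vstar x e u t) ≤ B := fun t => hF.regret_le hB hopt (x t)
    (pricingAlgorithm_price_nonneg hB hsel _ _ (hu t))
  have hexpl : ∑ t ∈ Finset.Ico l a, (revenue F (vstar (x t)) (pstar (x t)) -
      revenue F (vstar (x t)) (postedPrice pol vstar x e u t)) ≤ Te * B := by
    refine (Finset.sum_le_card_nsmul _ _ _ fun t _ => hreg t).trans ?_
    rw [Nat.card_Ico, nsmul_eq_mul, ha, Nat.add_sub_cancel_left]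
  have hexplΦ : (Te : ℝ) * B ≤ 2 * Φ * B := mul_le_mul_of_nonneg_right hTeΦ hB.le
  rw [hsplit, ← Finset.sum_Ico_consecutive _ (by omega : l ≤ a) (by omega : a ≤ a + n)]
  -- Exploration costs at most `2 Φ B`, which accounts for the difference between `309` and `307`.
  suffices hucb : ∑ t ∈ Finset.Ico a (a + n), (revenue F (vstar (x t)) (pstar (x t)) -
      revenue F (vstar (x t)) (postedPrice pol vstar x e u t)) ≤
      (307 * B + 2 + 8 * (B * L)) * (Real.log (T / δ) ^ 2 * Φ) by linarith
  -- The numerical bounds need a phase of at least two rounds, which also means that the cap on the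
  -- exploration length is inactive. A shorter phase costs at most `B`.
  rcases le_or_gt 2 n with hn2 | hn2
  · have hlt : explorationLength ρ α k < episodeLength k := by omega
    obtain ⟨herr1, herrl⟩ := oracle_error_le hρ.le hα hlt
    rw [← hTe] at herr1 herrl
    have hnl : (n : ℝ) ≤ l := by exact_mod_cast (by omega : n ≤ l)
    have hnerr : n * Real.sqrt (ρ / (Te : ℝ) ^ α) ≤ Φ :=
      (mul_le_mul_of_nonneg_right hnl (Real.sqrt_nonneg _)).trans (herrl.trans hX2)
    obtain ⟨hΛ0, hbound⟩ := phase_bound_le hB hL0 hn2 (by omega : n ≤ T) hδ hδ2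
      (Real.sqrt_nonneg _) herr1 hnerr hX1
    have hn0 : (0 : ℝ) < n := by exact_mod_cast (by omega : 0 < n)
    have hn1 : (1 : ℝ) ≤ n := by exact_mod_cast (by omega : 1 ≤ n)
    subst hTe
    exact (hF.phase_regret_le hB hL0 hopt hsel hu hk hkρ hTeℓ hv herr ha hn rfl rfl
      (numArms_bounds hn2 hδ hδ2).1 (one_le_numLayers hn2) rfl hΛ0 (by positivity)
      (Real.rpow_le_one_of_one_le_of_nonpos hn1 (by norm_num)) hdev).trans hbound
  · calc _ ≤ (Finset.Ico a (a + n)).card • B := Finset.sum_le_card_nsmul _ _ _ fun t _ => hreg t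
      _ = n * B := by rw [Nat.card_Ico, nsmul_eq_mul, Nat.add_sub_cancel_left]
      _ ≤ 1 * B := mul_le_mul_of_nonneg_right (by exact_mod_cast (by omega : n ≤ 1)) hB.le
      _ ≤ B * (Real.log (T / δ) ^ 2 * Φ) := by
        rw [mul_comm]
        exact mul_le_mul_of_nonneg_left (hΦ1.trans hΦE) hB.le
      _ ≤ _ := by
        refine mul_le_mul_of_nonneg_right ?_ (by positivity)
        have : 0 ≤ B * L := by positivity
        linarith

end Episode

/-! ### Assembly of the high-probability bound. -/

/-- Valuations at most `B - Bε` and noise at most `Bε` mean that a price of `B` or more exceeds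
every willingness to pay by a nonnegative margin, so `F` equals `1` there. -/
lemma isRegularMarket_cdf {X : Type*} {vstar : X → ℝ} {B Bε L : ℝ} {ν : Measure ℝ}
    [IsProbabilityMeasure ν] (hBε : 0 < Bε) (hbd : ∀ᵐ z ∂ν, |z| ≤ Bε)
    (hrange : ∀ z, vstar z ∈ Set.Icc Bε (B - Bε))
    (hL : ∀ a b, |cdf ν a - cdf ν b| ≤ L * |a - b|) : IsRegularMarket (cdf ν) vstar B L where
  mem_Icc c := ⟨cdf_nonneg ν c, cdf_le_one ν c⟩
  mono := monotone_cdf ν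
  lipschitz := hL
  eq_one x p hp := by
    have hae : ∀ᵐ z ∂ν, z ∈ Set.Iic (p - vstar x) := by
      filter_upwards [hbd] with z hz
      have := (hrange x).2
      exact Set.mem_Iic.2 (by linarith [le_of_abs_le hz])
    rw [cdf_eq_real, Measure.real, (mem_ae_iff_prob_eq_one measurableSet_Iic).1 hae, ENNReal.toReal_one]
  abs_le x := by
    have := hrange x
    rw [abs_of_nonneg (by linarith [this.1])]
    linarith [this.2]

lemma ae_uniform_draw_nonneg {Ω X : Type*} [MeasurableSpace Ω] [MeasurableSpace X] {μ : Measure Ω}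
    {PX : Measure X} [IsProbabilityMeasure PX] {ν : Measure ℝ} [IsProbabilityMeasure ν] {B : ℝ}
    (hB : 0 < B) {x : ℕ → Ω → X} {e u : ℕ → Ω → ℝ} (hm : IsMarket μ PX ν B x e u) :
    ∀ᵐ ω ∂μ, ∀ t, 0 ≤ u t ω := by
  have := isProbabilityMeasure_uniformPrice hB
  refine ae_all_iff.2 fun t => ?_
  have hZ : Measurable fun ω => (x t ω, e t ω, u t ω) :=
    (hm.measurable_x t).prodMk ((hm.measurable_e t).prodMk (hm.measurable_u t))
  have hmap : μ.map (u t) = uniformPrice B := by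
    have : u t = (fun z : X × ℝ × ℝ => z.2.2) ∘ fun ω => (x t ω, e t ω, u t ω) := rfl
    rw [this, ← Measure.map_map (by fun_prop) hZ, hm.law t]
    change Measure.map (Prod.snd ∘ Prod.snd) _ = _
    rw [← Measure.map_map measurable_snd measurable_snd, Measure.map_snd_prod, Measure.map_smul,
      Measure.map_snd_prod]
    simp
  have hae : ∀ᵐ y ∂(uniformPrice B), 0 ≤ y := by
    have h1 : ∀ᵐ y ∂(uniformPrice B), y ∈ Set.Ioo 0 B := ae_cond_mem measurableSet_Ioo
    filter_upwards [h1] with y hy using hy.1.le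
  rw [← hmap] at hae
  exact ae_of_ae_map (hm.measurable_u t).aemeasurable hae

/-- The high-probability regret bound for the episodic pricing algorithm on an arbitrary context
space. -/
theorem measure_regret_le {Ω X : Type*} [MeasurableSpace Ω] [MeasurableSpace X] {μ : Measure Ω}
    [IsProbabilityMeasure μ] {PX : Measure X} [IsProbabilityMeasure PX] {ν : Measure ℝ}
    [IsProbabilityMeasure ν] {B L Bε ρ α δ : ℝ} (hB : 0 < B) (hL0 : 0 < L)
    {x : ℕ → Ω → X} {e u : ℕ → Ω → ℝ} (hm : IsMarket μ PX ν B x e u) {V : Set (X → ℝ)}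
    {vstar pstar : X → ℝ} (hv : Measurable vstar) (hmean : ∫ z, z ∂ν = 0) (hBε : 0 < Bε)
    (hbd : ∀ᵐ z ∂ν, |z| ≤ Bε) (hrange : ∀ z, vstar z ∈ Set.Icc Bε (B - Bε))
    (hL : ∀ a b, |cdf ν a - cdf ν b| ≤ L * |a - b|)
    (hopt : IsOptimalPricing (cdf ν) vstar pstar) {T : ℕ} (hT : 2 ≤ T) (hδ : 0 < δ)
    (hδK : δ < 1 / (2 * ⌈Real.logb 2 T⌉₊)) (hα : 0 < α) (hρ : 1 < ρ) {orc : Oracle X}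
    (hmorc : MeasurableOracle orc)
    (horc : IsGeneralOfflineOracle V B vstar ρ α δ (explorationLaw PX ν B vstar) orc)
    {sel : Selector X} (hsel : AdmissibleSelector sel) :
    μ {ω | ¬ regret (cdf ν) (pricingAlgorithm B ρ δ (explorationLength ρ α) orc sel)
          vstar pstar (fun t => x t ω) (fun t => e t ω) (fun t => u t ω) T
        ≤ (B + 3 * (309 * B + 2 + 8 * (B * L))) * Real.log (T / δ) ^ 3 *
          max (ρ ^ (1 / 3 : ℝ) * (T : ℝ) ^ (2 / 3 : ℝ))
            (ρ ^ (1 / (2 + α)) * (T : ℝ) ^ (2 / (2 + α)))}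
      ≤ ENNReal.ofReal (2 * ⌈Real.logb 2 T⌉₊ * δ) := by
  have hF := isRegularMarket_cdf hBε hbd hrange hL
  have hT2 : (2 : ℝ) ≤ T := by exact_mod_cast hT
  have hlogT : 0 < Real.logb 2 T := Real.logb_pos (by norm_num) (by linarith)
  have hK1 : 1 ≤ ⌈Real.logb 2 T⌉₊ := Nat.one_le_ceil_iff.2 hlogT
  have hK1' : (1 : ℝ) ≤ ⌈Real.logb 2 T⌉₊ := by exact_mod_cast hK1
  have hδ2 : δ ≤ 1 / 2 := hδK.le.trans (by
    rw [div_le_div_iff₀ (by linarith) (by norm_num)]; linarith)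
  obtain ⟨-, hE⟩ := one_le_log_div hT2 hδ hδ2
  -- This comparison turns the number of episodes into the third power of the logarithm.
  have hKE : (⌈Real.logb 2 T⌉₊ : ℝ) ≤ 3 * Real.log (T / δ) := by
    have h1 := Nat.ceil_lt_add_one hlogT.le
    have h2 : Real.log T ≤ Real.log (T / δ) := by
      refine Real.log_le_log (by linarith) ?_
      rw [le_div_iff₀ hδ]
      nlinarith
    have h3 := logb_two_le (by linarith) h2
    linarith
  set pol := pricingAlgorithm B ρ δ (explorationLength ρ α) orc sel with hpol
  have hpolm : MeasurablePolicy pol := measurablePolicy_pricingAlgorithm B ρ δ _ hmorc hsel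
  set E := Real.log (T / δ) with hEdef
  set Φ := max (ρ ^ (1 / 3 : ℝ) * (T : ℝ) ^ (2 / 3 : ℝ))
            (ρ ^ (1 / (2 + α)) * (T : ℝ) ^ (2 / (2 + α))) with hΦ
  set K := ⌈Real.logb 2 T⌉₊ with hK
  have hΦ0 : 0 ≤ Φ := le_max_of_le_left (by positivity)
  set H := fun ω t => history pol vstar (fun i => x i ω) (fun i => e i ω) (fun i => u i ω) t with hH
  let bad₁ : ℕ → Set Ω := fun k => {ω | ¬ ∀ y, |orc (explorationLength ρ α k)
      (fun i : Fin (explorationLength ρ α k) => (x (episodeLength k + i) ω,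
      decide (u (episodeLength k + i) ω ≤ vstar (x (episodeLength k + i) ω) +
        e (episodeLength k + i) ω))) y - vstar y| ≤
        Real.sqrt (ρ / (explorationLength ρ α k : ℝ) ^ α)}
  let bad₂ : ℕ → Set Ω := fun k => {ω | ∃ t ∈ Finset.Ico (episodeLength k + explorationLength ρ α k)
        (episodeLength k + explorationLength ρ α k + (episodeLength k - explorationLength ρ α k)),
      ∃ s ∈ Finset.Icc 1 (numLayers (episodeLength k - explorationLength ρ α k)),
      ∃ j ∈ Finset.Icc 1 (numArms (episodeLength k - explorationLength ρ α k) δ),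
        0 < (armRounds (episodeLength k + explorationLength ρ α k) (H ω t) s j).card ∧
        (armRounds (episodeLength k + explorationLength ρ α k) (H ω t) s j).card *
          Real.sqrt (2 * Real.log (2 * numLayers (episodeLength k - explorationLength ρ α k) *
            numArms (episodeLength k - explorationLength ρ α k) δ *
            (episodeLength k - explorationLength ρ α k : ℕ) / δ) /
            (armRounds (episodeLength k + explorationLength ρ α k) (H ω t) s j).card) <
        |∑ τ ∈ armRounds (episodeLength k + explorationLength ρ α k) (H ω t) s j,
          excess (cdf ν) vstar (H ω t τ)|}
  have hbad : ∀ k ∈ Finset.Icc (firstEpisode ρ) K,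
      μ (bad₁ k ∪ bad₂ k) ≤ ENNReal.ofReal (2 * δ) := fun k _ => by
    rw [two_mul, ENNReal.ofReal_add hδ.le hδ.le]
    refine (measure_union_le _ _).trans (add_le_add ?_ ?_)
    · exact measure_oracle_error_le hB hm hv hmean hbd hrange horc _ _
        (explorationLength_pos hρ.le hα k)
    · exact measure_phase_deviation_le hpolm hv hB hm hL _ _ _ _ hδ (by linarith)
  have hunion : μ (⋃ k ∈ Finset.Icc (firstEpisode ρ) K, (bad₁ k ∪ bad₂ k)) ≤
      ENNReal.ofReal (2 * K * δ) := by
    refine (measure_biUnion_finset_le _ _).trans ((Finset.sum_le_sum hbad).trans ?_)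
    rw [Finset.sum_const, nsmul_eq_mul, ← ENNReal.ofReal_natCast,
      ← ENNReal.ofReal_mul (Nat.cast_nonneg _)]
    refine ENNReal.ofReal_le_ofReal ?_
    have hcard : (Finset.Icc (firstEpisode ρ) K).card ≤ K := by
      have := firstEpisode_pos hρ
      simp only [Nat.card_Icc]
      omega
    have hcard' : ((Finset.Icc (firstEpisode ρ) K).card : ℝ) ≤ K := by exact_mod_cast hcard
    nlinarith
  -- The inclusion is only almost sure, because the uniform draws are nonnegative only almost
  -- surely.
  refine le_trans (measure_mono_ae ?_) hunion
  filter_upwards [ae_uniform_draw_nonneg hB hm] with ω hu hω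
  by_contra hgood
  refine hω ?_
  have hgood' : ∀ k ∈ Finset.Icc (firstEpisode ρ) K, ω ∉ bad₁ k ∧ ω ∉ bad₂ k := fun k hk =>
    ⟨fun h => hgood (Set.mem_biUnion hk (Or.inl h)), fun h => hgood (Set.mem_biUnion hk (Or.inr h))⟩
  have hep : ∀ k ∈ Finset.Icc (firstEpisode ρ) K,
      ∑ t ∈ Finset.Ico (episodeLength k) (2 * episodeLength k),
        (revenue (cdf ν) (vstar (x t ω)) (pstar (x t ω)) - revenue (cdf ν) (vstar (x t ω))
          (postedPrice pol vstar (fun t => x t ω) (fun t => e t ω) (fun t => u t ω) t)) ≤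
      (309 * B + 2 + 8 * (B * L)) * (E ^ 2 * Φ) := fun k hk => by
    obtain ⟨h1, h2⟩ := hgood' k hk
    obtain ⟨hk1, hk2⟩ := Finset.mem_Icc.1 hk
    have hk0 : 1 ≤ k := (firstEpisode_pos hρ).trans hk1
    refine hF.episode_regret_le (x := fun t => x t ω) (e := fun t => e t ω)
      (u := fun t => u t ω) (k := k) hB hL0.le hopt hsel.1 hu hρ hα hδ hδ2 hk0 hk1 hT
      (episodeLength_lt hT hk0 hk2) rfl rfl rfl rfl ?_ ?_
    · exact not_not.1 h1
    · rintro t ht s hs j hj h rfl hpos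
      by_contra hlt
      exact h2 ⟨t, ht, s, hs, j, hj, hpos, not_le.1 hlt⟩
  have hsum := sum_range_le_sum_episodes hρ hB.le (by omega : 0 < T)
    (fun t => hF.regret_nonneg hopt (x t ω) (postedPrice pol vstar (fun t => x t ω)
      (fun t => e t ω) (fun t => u t ω) t))
    (fun t => hF.regret_le hB hopt (x t ω)
      (pricingAlgorithm_price_nonneg hB hsel.1 _ _ (hu t)))
  refine hsum.trans ?_
  set C₁ := 309 * B + 2 + 8 * (B * L) with hC₁
  have hC₁0 : 0 ≤ C₁ := by positivity
  have hcount : ∑ k ∈ Finset.Icc (firstEpisode ρ) K,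
      ∑ t ∈ Finset.Ico (episodeLength k) (2 * episodeLength k),
        (revenue (cdf ν) (vstar (x t ω)) (pstar (x t ω)) - revenue (cdf ν) (vstar (x t ω))
          (postedPrice pol vstar (fun t => x t ω) (fun t => e t ω) (fun t => u t ω) t)) ≤
      3 * E * (C₁ * (E ^ 2 * Φ)) := by
    refine (Finset.sum_le_card_nsmul _ _ _ hep).trans ?_
    rw [nsmul_eq_mul]
    refine mul_le_mul_of_nonneg_right (le_trans ?_ hKE) (by positivity)
    have := firstEpisode_pos hρ
    have : (Finset.Icc (firstEpisode ρ) K).card ≤ K := by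
      simp only [Nat.card_Icc]; omega
    exact_mod_cast this
  have hwarm : B * (ρ ^ (1 / 3 : ℝ) * (T : ℝ) ^ (2 / 3 : ℝ)) ≤ B * (E ^ 3 * Φ) :=
    mul_le_mul_of_nonneg_left ((le_max_left _ _).trans
      (le_mul_of_one_le_left hΦ0 (one_le_pow₀ hE))) hB.le
  calc _ ≤ B * (E ^ 3 * Φ) + 3 * E * (C₁ * (E ^ 2 * Φ)) := add_le_add hwarm hcount
    _ = (B + 3 * C₁) * E ^ 3 * Φ := by ring

end DynamicPricing

theorem mainTheorem4 :
    ∃ κ : ℕ, ∀ B L : ℝ, 0 < B → 0 < L → ∃ C : ℝ, 0 < C ∧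
      ∀ (d₀ : ℕ) (𝒳 : Set (EuclideanSpace ℝ (Fin d₀))) (V : Set (𝒳 → ℝ)) (vstar pstar : 𝒳 → ℝ)
        (Bε : ℝ) (PX : Measure 𝒳) (ν : Measure ℝ) (ρ α δ : ℝ) (T : ℕ)
        (orc : DynamicPricing.Oracle 𝒳) (sel : DynamicPricing.Selector 𝒳)
        (Ω : Type*) (_ : MeasurableSpace Ω) (μ : Measure Ω)
        (x : ℕ → Ω → 𝒳) (e u : ℕ → Ω → ℝ),
        IsProbabilityMeasure PX → IsProbabilityMeasure ν → IsProbabilityMeasure μ →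
        DynamicPricing.IsMarket μ PX ν B x e u →
        -- realizability
        Measurable vstar → vstar ∈ V →
        -- centred, bounded noise and bounded valuations
        ∫ z, z ∂ν = 0 → 0 < Bε → (∀ᵐ z ∂ν, |z| ≤ Bε) →
        (∀ z, vstar z ∈ Set.Icc Bε (B - Bε)) →
        -- Lipschitz noise distribution
        (∀ a b, |cdf ν a - cdf ν b| ≤ L * |a - b|) →
        -- optimal prices
        DynamicPricing.IsOptimalPricing (cdf ν) vstar pstar →
        -- the parameters
        2 ≤ T → 0 < δ → δ < 1 / (2 * ⌈Real.logb 2 T⌉₊) → 0 < α → 1 < ρ →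
        -- the regression oracle and the rule for arbitrary choices
        DynamicPricing.MeasurableOracle orc →
        DynamicPricing.IsGeneralOfflineOracle V B vstar ρ α δ
          (DynamicPricing.explorationLaw PX ν B vstar) orc →
        DynamicPricing.AdmissibleSelector sel →
        μ {ω | ¬ DynamicPricing.regret (cdf ν)
              (DynamicPricing.pricingAlgorithm B ρ δ (DynamicPricing.explorationLength ρ α) orc sel)
              vstar pstar (fun t => x t ω) (fun t => e t ω) (fun t => u t ω) T
            ≤ C * Real.log (T / δ) ^ κ *
              max (ρ ^ (1 / 3 : ℝ) * (T : ℝ) ^ (2 / 3 : ℝ))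
                (ρ ^ (1 / (2 + α)) * (T : ℝ) ^ (2 / (2 + α)))}
          ≤ ENNReal.ofReal (2 * ⌈Real.logb 2 T⌉₊ * δ) := by
  refine ⟨3, fun B L hB hL => ⟨B + 3 * (309 * B + 2 + 8 * (B * L)), by positivity, ?_⟩⟩
  intro d₀ 𝒳 V vstar pstar Bε PX ν ρ α δ T orc sel Ω _ μ x e u _ _ _ hm hv _ hmean hBε hbd hrange
    hLip hopt hT hδ hδK hα hρ hmorc horc hsel
  exact DynamicPricing.measure_regret_le hB hL hm hv hmean hBε hbd hrange hLip hopt hT hδ hδK hα hρ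
    hmorc horc hsel
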